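/- **Definitions.** A *$\mathbb{Q}$-system* $(X,\mu,T)$ is a compact metrizable space $X$ with an action $T=(T^q)_{q\in\mathbb{Q}}$ of $(\mathbb{Q},+)$ by homeomorphisms and a $T$-invariant Borel probability measure $\mu$. It is *ergodic* if every Borel set $A$ with $\mu(A\,\triangle\,T^{-q}A)=0$ for all $q\in\mathbb{Q}$ has $\mu(A)\in\{0,1\}$. For $g\in L^\infty(\mu)$ put $\Delta_q g=\overline{g}\cdot (g\circ T^q)$. Call $g$ a *phase polynomial of degree at most $k$* if $\Delta_{q_{k+1}}\cdots\Delta_{q_1}g=1$ almost everywhere for all $q_1,\dots,q_{k+1}\in\mathbb{Q}$. The system is *Abramov of order at most $k$* if the linear span of the phase polynomials of degree at most $k$ is dense in $L^2(\mu)$. A *factor map* $(Y,\nu,S)\to(X,\mu,T)$ is a measurable map $\pi:Y\to X$ with $\pi_*\nu=\mu$ and, for every $q\in\mathbb{Q}$, $\pi\circ S^q=T^q\circ\pi$ almost everywhere; then $(X,\mu,T)$ is a *factor* of $(Y,\nu,S)$. It is a *measurable isomorphism* if it has an almost everywhere inverse that is also a factor map. A *compact $\mathbb{Q}$-vector space*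 is a compact metrizable abelian topological group that is a vector space over $\mathbb{Q}$ (scalar multiplication by each rational is then continuous). For such a space $V$ with Haar probability measure $m_V$, an element $\alpha\in V$ and an integer $k\ge 0$, let $S$ be the action of $\mathbb{Q}$ on $(V^k,m_V^k)$ given by $$S^q(v)_j=v_j+\sum_{i=1}^{j-1}\binom{q}{j-i}v_i+\binom{q}{j}\alpha\qquad(1\le j\le k),$$ where $\binom{q}{n}=q(q-1)\cdots(q-n+1)/n!$. The triple $(V^k,m_V^k,S)$ is a $\mathbb{Q}$-system. **Theorem.** Let $k\ge 0$ and let $(X,\mu,T)$ be an ergodic Abramov $\mathbb{Q}$-system of order at most $k$. Then there exist a compact $\mathbb{Q}$-vector space $V$ and an element $\alpha\in V$ such that $(X,\mu,T)$ is a factor of $(V^k,m_V^k,S)$. Moreover, up to replacing $(X,\mu,T)$ by a measurably isomorphic system, the factor map may be taken continuous: for the same $V$ and $\alpha$, there are a factor map $\pi:V^k\to X$, a $\mathbb{Q}$-system $(\tilde X,\tilde\mu,\tilde T)$, a measurable isomorphism $\varphi:X\to\tilde X$, and a continuous surjective map $\tilde\pi:V^k\to\tilde X$ such that $\tilde\pi_*m_V^k=\tilde\mu$,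 $\tilde\pi\circ S^q=\tilde T^q\circ\tilde\pi$ everywhere for every $q\in\mathbb{Q}$, and $\tilde\pi=\varphi\circ\pi$ almost everywhere. -/

import Mathlib

open MeasureTheory
open scoped ComplexConjugate

universe u v w

/-- A measure-preserving `ℚ`-system `(X, μ, T)`: a compact metrizable space `X` with an action `T`
of `(ℚ, +)` by homeomorphisms and a `T`-invariant Borel probability measure `μ`.
The map `T^q` is `x ↦ q +ᵥ x`. -/
structure QSystem : Type (u + 1) where
  carrier : Type u
  [topology : TopologicalSpace carrier]
  [compact : CompactSpace carrier]
  [metrizable : TopologicalSpace.MetrizableSpace carrier]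
  [measurable : MeasurableSpace carrier]
  [borel : BorelSpace carrier]
  [action : AddAction ℚ carrier]
  [continuousAction : ContinuousConstVAdd ℚ carrier]
  μ : Measure carrier
  [probability : IsProbabilityMeasure μ]
  [invariant : VAddInvariantMeasure ℚ carrier μ]

namespace QSystem

instance : CoeSort QSystem.{u} (Type u) := ⟨QSystem.carrier⟩

attribute [instance] topology compact metrizable measurable borel action continuousAction
  probability invariant

/-- Every Borel set that is `T^q`-invariant modulo null sets for all `q : ℚ` is null or conull. -/
def IsErgodic (X : QSystem.{u}) : Prop := ErgodicVAdd ℚ X X.μ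

/-- The multiplicative derivative `Δ_q g = conj g · T^q g`. -/
def mulDeriv (X : QSystem.{u}) (q : ℚ) (g : X → ℂ) : X → ℂ :=
  fun x => conj (g x) * g (q +ᵥ x)

/-- The iterated derivative
`Δ^(n+1)_{q_1, …, q_(n+1)} g = Δ_{q_(n+1)} (Δ^n_{q_1, …, q_n} g)`. -/
def iterMulDeriv (X : QSystem.{u}) : (n : ℕ) → (Fin n → ℚ) → (X → ℂ) → (X → ℂ)
  | 0, _, g => g
  | n + 1, q, g => X.mulDeriv (q (Fin.last n)) (X.iterMulDeriv n (fun i => q i.castSucc) g)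

/-- `g ∈ L^∞(μ)` is a phase polynomial of degree at most `k`: all its derivatives of
order `k + 1` are equal to `1` almost everywhere. -/
def IsPhasePolynomial (X : QSystem.{u}) (k : ℕ) (g : X → ℂ) : Prop :=
  MemLp g ⊤ X.μ ∧ ∀ q : Fin (k + 1) → ℚ, X.iterMulDeriv (k + 1) q g =ᵐ[X.μ] fun _ => 1

/-- `X` is an Abramov system of order at most `k`: it is equal to its Abramov factor of order `k`,
that is, the phase polynomials of degree at most `k` span a dense subspace of `L²(μ)`. -/
def IsAbramov (X : QSystem.{u}) (k : ℕ) : Prop :=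
  (Submodule.span ℂ {f : Lp ℂ 2 X.μ | X.IsPhasePolynomial k f}).topologicalClosure = ⊤

/-- `π : X → Y` is a (measurable) factor map: measurable, `π_* μ = ν`, and for every `q`,
`π ∘ T^q = S^q ∘ π` almost everywhere. -/
structure IsFactorMap (X : QSystem.{u}) (Y : QSystem.{v}) (π : X → Y) : Prop where
  measurePreserving : MeasurePreserving π X.μ Y.μ
  equivariant : ∀ q : ℚ, ∀ᵐ x ∂X.μ, π (q +ᵥ x) = q +ᵥ π x

/-- A factor map that is continuous and surjective, and equivariant everywhere. -/
structure IsTopologicalFactorMap (X : QSystem.{u}) (Y : QSystem.{v}) (π : X → Y) : Prop where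
  measurePreserving : MeasurePreserving π X.μ Y.μ
  continuous : Continuous π
  surjective : Function.Surjective π
  equivariant : ∀ (q : ℚ) (x : X), π (q +ᵥ x) = q +ᵥ π x

/-- `φ : X → Y` is a measurable isomorphism: a factor map that has a factor map `Y → X`
as an almost everywhere inverse. -/
def IsMeasurableIso (X : QSystem.{u}) (Y : QSystem.{v}) (φ : X → Y) : Prop :=
  X.IsFactorMap Y φ ∧ ∃ ψ : Y → X, Y.IsFactorMap X ψ ∧
    (∀ᵐ x ∂X.μ, ψ (φ x) = x) ∧ (∀ᵐ y ∂Y.μ, φ (ψ y) = y)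

end QSystem

section SkewProduct

variable {V : Type w} [AddCommGroup V] [Module ℚ V]

/-- The map `S^q(v)_j = v_j + ∑_{i < j} binom(q, j - i) v_i + binom(q, j) α` on `V^k`, where
`1 ≤ i, j ≤ k`. The coordinate `j : Fin k` is the coordinate number `j + 1` of `V^k`. -/
noncomputable def skewMap {k : ℕ} (α : V) (q : ℚ) (v : Fin k → V) : Fin k → V :=
  fun j => v j + ∑ i ∈ Finset.Iio j, Ring.choose q ((j : ℕ) - (i : ℕ)) • v i
    + Ring.choose q ((j : ℕ) + 1) • α

/-- The sequence `α, v_1, …, v_k, 0, 0, …`. -/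
def skewExt {k : ℕ} (α : V) (v : Fin k → V) : ℕ → V
  | 0 => α
  | n + 1 => if h : n < k then v ⟨n, h⟩ else 0

theorem skewMap_apply {k : ℕ} (α : V) (q : ℚ) (v : Fin k → V) (j : Fin k) :
    skewMap α q v j = ∑ p ∈ Finset.HasAntidiagonal.antidiagonal ((j : ℕ) + 1),
      Ring.choose q p.1 • skewExt α v p.2 := by
  rw [← Finset.Nat.sum_antidiagonal_swap,
    Finset.Nat.sum_antidiagonal_eq_sum_range_succ_mk, Finset.sum_range_succ',
    Finset.sum_range_succ]
  have h : ∑ i ∈ Finset.Iio j, Ring.choose q ((j : ℕ) - (i : ℕ)) • v i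
      = ∑ i ∈ Finset.range (j : ℕ), Ring.choose q ((j : ℕ) - i) • skewExt α v (i + 1) := by
    have e : Finset.range (j : ℕ) = (Finset.Iio j).map Fin.valEmbedding := by
      rw [Fin.map_valEmbedding_Iio]; ext; simp
    rw [e, Finset.sum_map]
    refine Finset.sum_congr rfl fun i _ => ?_
    simp [skewExt]
  simp only [skewMap, h]
  simp [skewExt, add_comm]

theorem skewExt_skewMap {k : ℕ} (α : V) (q : ℚ) (v : Fin k → V) {m : ℕ} (hm : m ≤ k) :
    skewExt α (skewMap α q v) m
      = ∑ p ∈ Finset.HasAntidiagonal.antidiagonal m, Ring.choose q p.1 • skewExt α v p.2 := by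
  cases m with
  | zero => simp [skewExt]
  | succ n =>
    have hn : n < k := hm
    rw [skewExt, dif_pos hn, skewMap_apply]

theorem skewMap_zero {k : ℕ} (α : V) (v : Fin k → V) : skewMap α 0 v = v := by
  funext j
  rw [skewMap, Ring.choose_zero_pos ℚ (Nat.succ_pos _), Finset.sum_eq_zero]
  · simp
  · intro i hi
    have : i < j := Finset.mem_Iio.1 hi
    rw [Ring.choose_zero_pos ℚ (by lia), zero_smul]

theorem skewMap_add {k : ℕ} (α : V) (q r : ℚ) (v : Fin k → V) :
    skewMap α (q + r) v = skewMap α q (skewMap α r v) := by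
  funext j
  rw [skewMap_apply, skewMap_apply]
  have h : ∀ p ∈ Finset.HasAntidiagonal.antidiagonal ((j : ℕ) + 1),
      Ring.choose q p.1 • skewExt α (skewMap α r v) p.2
        = ∑ s ∈ Finset.HasAntidiagonal.antidiagonal p.2,
          (Ring.choose q p.1 * Ring.choose r s.1) • skewExt α v s.2 := by
    intro p hp
    have := Finset.HasAntidiagonal.mem_antidiagonal.1 hp
    rw [skewExt_skewMap α r v (by omega), Finset.smul_sum]
    simp only [mul_smul]
  rw [Finset.sum_congr rfl h]
  simp only [Ring.add_choose_eq _ (Commute.all q r), Finset.sum_smul]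
  rw [Finset.sum_sigma', Finset.sum_sigma']
  refine Finset.sum_nbij' (fun ⟨⟨_, d⟩, ⟨a, b⟩⟩ => ⟨(a, b + d), (b, d)⟩)
    (fun ⟨⟨a, _⟩, ⟨b, d⟩⟩ => ⟨(a + b, d), (a, b)⟩) ?_ ?_ ?_ ?_ ?_
  · rintro ⟨⟨c, d⟩, ⟨a, b⟩⟩ h
    simp at h ⊢; lia
  · rintro ⟨⟨a, c⟩, ⟨b, d⟩⟩ h
    simp at h ⊢; lia
  · rintro ⟨⟨c, d⟩, ⟨a, b⟩⟩ h
    simp at h; simp [h]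
  · rintro ⟨⟨a, c⟩, ⟨b, d⟩⟩ h
    simp at h; simp [h]
  · rintro ⟨⟨c, d⟩, ⟨a, b⟩⟩ h
    rfl

/-- The linear part of `skewMap α q`. -/
noncomputable def skewHom (k : ℕ) (q : ℚ) : (Fin k → V) →+ (Fin k → V) where
  toFun := skewMap 0 q
  map_zero' := by funext j; simp [skewMap]
  map_add' x y := by
    funext j
    simp only [skewMap, Pi.add_apply, smul_add, Finset.sum_add_distrib, smul_zero, add_zero]
    abel

theorem skewMap_surjective {k : ℕ} (α : V) (q : ℚ) :
    Function.Surjective (skewMap α q : (Fin k → V) → (Fin k → V)) := fun v =>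
  ⟨skewMap α (-q) v, by rw [← skewMap_add, add_neg_cancel, skewMap_zero]⟩

variable [TopologicalSpace V] [IsTopologicalAddGroup V] [ContinuousConstSMul ℚ V]

theorem continuous_skewMap {k : ℕ} (α : V) (q : ℚ) :
    Continuous (skewMap α q : (Fin k → V) → (Fin k → V)) := by
  unfold skewMap
  fun_prop

variable [CompactSpace V] [MeasurableSpace V] [BorelSpace V]

variable (V) in
/-- The Haar probability measure `m_V` of a compact group `V`. -/
noncomputable def haarProb : Measure V :=
  Measure.addHaarMeasure (⊤ : TopologicalSpace.PositiveCompacts V)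

instance : (haarProb V).IsAddHaarMeasure := by
  unfold haarProb; infer_instance

instance : IsProbabilityMeasure (haarProb V) :=
  ⟨by simpa [haarProb] using
    Measure.addHaarMeasure_self (K₀ := (⊤ : TopologicalSpace.PositiveCompacts V))⟩

variable [TopologicalSpace.MetrizableSpace V]

theorem measurePreserving_skewMap {k : ℕ} (α : V) (q : ℚ) :
    MeasurePreserving (skewMap α q : (Fin k → V) → (Fin k → V))
      (Measure.pi fun _ => haarProb V) (Measure.pi fun _ => haarProb V) := by
  haveI : SecondCountableTopology V := by
    letI := TopologicalSpace.metrizableSpaceMetric V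
    infer_instance
  have h1 : MeasurePreserving (skewHom k q : (Fin k → V) → (Fin k → V))
      (Measure.pi fun _ => haarProb V) (Measure.pi fun _ => haarProb V) :=
    AddMonoidHom.measurePreserving (f := skewHom (V := V) k q) (continuous_skewMap 0 q)
      (skewMap_surjective 0 q) rfl
  have h2 := measurePreserving_add_right (Measure.pi fun _ : Fin k => haarProb V)
    (fun j : Fin k => Ring.choose q ((j : ℕ) + 1) • α)
  convert h2.comp h1 using 1
  funext v j
  simp [skewHom, skewMap]

/-- The unipotent affine skew product `(V^k, m_V^k, S)` with `S^q = skewMap α q`. -/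
noncomputable def skewProduct (k : ℕ) (α : V) : QSystem.{w} :=
  haveI : SecondCountableTopology V := by
    letI := TopologicalSpace.metrizableSpaceMetric V
    infer_instance
  letI : AddAction ℚ (Fin k → V) :=
    { vadd := skewMap α
      zero_vadd := skewMap_zero α
      add_vadd := skewMap_add α }
  { carrier := Fin k → V
    continuousAction := ⟨continuous_skewMap α⟩
    μ := Measure.pi fun _ => haarProb V
    invariant := ⟨fun q _ hs => (measurePreserving_skewMap α q).measure_preimage
      hs.nullMeasurableSet⟩ }

end SkewProduct

/-! Write phase polynomials additively, as functions into `ℝ/ℤ`. By ergodicity the phase of a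
non-constant one has integral zero (`phaseIntegral_eq_zero`). Hence the polynomials of degree at
most `k` are the sum of the constants and a countable torsion-free group `P`, and `T^q` acts on `P`
by a unipotent `u q`, up to a cocycle `c q` of constants (`exists_polynomial_group`). Evaluating all
of `P` at a point sends `X` to the compact dual of `P`, with Haar measure as image and an affine
action; the Abramov hypothesis makes this map invertible modulo null sets.

It remains to cover that affine system by a skew product. On the divisible hull `W` of `P`,
unipotence gives `U_q = (1 + D)^q = ∑ binom(q, m) D^m` with `D = U_1 - 1`, and the cocycle becomes
`c_q = A ∘ ((1 + D)^q - 1)/D` for a single character `A` of `W` (`exists_unipotent_embedding`). Let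
`V` be the dual of `W` and `α = A`. The homomorphism sending `v` to `p ↦ ∑_{j<k} v_j(D^j p)` is
continuous and, since `ℝ/ℤ` is divisible, onto the dual of `P`; so it carries Haar measure to Haar
measure. Its equivariance is the binomial expansion read dually (`piDual_skewMap`). -/

/-- Divisible groups are injective. This one fact splits off the constants, produces `A`, separates
points of `P` by characters and gives surjectivity of `piDual`. -/
theorem UnitAddCircle.exists_extension {M N : Type*} [AddCommGroup M] [AddCommGroup N]
    (f : M →+ N) (g : M →+ UnitAddCircle) (h : ∀ x, f x = 0 → g x = 0) :
    ∃ A : N →+ UnitAddCircle, ∀ x, A (f x) = g x := by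
  obtain ⟨A, hA⟩ := (Module.Baer.of_divisible UnitAddCircle).extension_property_addMonoidHom
    (QuotientAddGroup.kerLift f) (QuotientAddGroup.kerLift_injective f)
    (QuotientAddGroup.lift f.ker g fun x hx => h x hx)
  exact ⟨A, fun x => DFunLike.congr_fun hA (x : M ⧸ f.ker)⟩

theorem Rat.addSubgroup_eq_top {H : AddSubgroup ℚ} (h : ∀ n : ℕ, n ≠ 0 → (n : ℚ)⁻¹ ∈ H) (q : ℚ) :
    q ∈ H := by
  have := H.zsmul_mem (h q.den q.den_ne_zero) q.num
  rwa [zsmul_eq_mul, ← div_eq_mul_inv, Rat.num_div_den] at this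

/-! ### Unipotent actions of `ℚ` as binomial series. -/

section NilpotentEval

variable {R : Type*} [Ring R] [Algebra ℚ R]

theorem Polynomial.aeval_eq_sum_range_of_pow_eq_zero {D : R} {n : ℕ} (hD : D ^ n = 0)
    (p : Polynomial ℚ) : Polynomial.aeval D p = ∑ i ∈ Finset.range n, p.coeff i • D ^ i := by
  rw [Polynomial.aeval_eq_sum_range' (n := max n (p.natDegree + 1)) (by simp)]
  symm
  refine Finset.sum_subset (by simp) fun i _ hi => ?_
  rw [pow_eq_zero_of_le (by simpa using hi) hD, smul_zero]

/-- Evaluation of power series at an element `D` with `D ^ n = 0`. -/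
noncomputable def nilpotentEval {D : R} {n : ℕ} (hD : D ^ n = 0) : PowerSeries ℚ →+* R where
  toFun f := ∑ i ∈ Finset.range n, PowerSeries.coeff i f • D ^ i
  map_zero' := by simp
  map_add' f g := by simp [add_smul, Finset.sum_add_distrib]
  map_one' := by
    have := Polynomial.aeval_eq_sum_range_of_pow_eq_zero hD 1
    rw [map_one] at this
    rw [this]
    simp [PowerSeries.coeff_one, Polynomial.coeff_one]
  map_mul' f g := by
    have h (f : PowerSeries ℚ) : ∑ i ∈ Finset.range n, PowerSeries.coeff i f • D ^ i
        = Polynomial.aeval D (PowerSeries.trunc n f) := by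
      rw [Polynomial.aeval_eq_sum_range_of_pow_eq_zero hD]
      refine Finset.sum_congr rfl fun i hi => ?_
      rw [PowerSeries.coeff_trunc, if_pos (Finset.mem_range.1 hi)]
    rw [h f, h g, ← map_mul, Polynomial.aeval_eq_sum_range_of_pow_eq_zero hD]
    refine Finset.sum_congr rfl fun i hi => ?_
    rw [PowerSeries.coeff_mul_eq_coeff_trunc_mul_trunc f g (Finset.mem_range.1 hi),
      ← Polynomial.coe_mul, Polynomial.coeff_coe]

theorem nilpotentEval_apply {D : R} {n : ℕ} (hD : D ^ n = 0) (f : PowerSeries ℚ) :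
    nilpotentEval hD f = ∑ i ∈ Finset.range n, PowerSeries.coeff i f • D ^ i := rfl

theorem nilpotentEval_X {D : R} {n : ℕ} (hD : D ^ n = 0) :
    nilpotentEval hD PowerSeries.X = D := by
  have := Polynomial.aeval_eq_sum_range_of_pow_eq_zero hD Polynomial.X
  rw [Polynomial.aeval_X] at this
  rw [nilpotentEval_apply]
  conv_rhs => rw [this]
  simp [PowerSeries.coeff_X, Polynomial.coeff_X, eq_comm]

theorem Commute.nilpotentEval {D x : R} {n : ℕ} (hD : D ^ n = 0) (h : Commute x D)
    (f : PowerSeries ℚ) : Commute x (nilpotentEval hD f) := by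
  rw [nilpotentEval_apply]
  exact Commute.sum_right _ _ _ fun i _ => (h.pow_right i).smul_right _

theorem isNilpotent_nilpotentEval {D : R} {n : ℕ} (hD : D ^ n = 0) {f : PowerSeries ℚ}
    (hf : PowerSeries.constantCoeff f = 0) : IsNilpotent (nilpotentEval hD f) := by
  obtain ⟨g, rfl⟩ := PowerSeries.X_dvd_iff.2 hf
  rw [map_mul, nilpotentEval_X]
  exact ((Commute.refl D).nilpotentEval hD g).isNilpotent_mul_right ⟨n, hD⟩

/-- In `x^N - 1 = (x - 1)(1 + ⋯ + x^(N-1))` the second factor is a unit: as a power series in the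
nilpotent `x - 1` it has constant term `N`. -/
theorem eq_one_of_pow_eq_one_of_isNilpotent {x : R} (h : IsNilpotent (x - 1)) {N : ℕ} (hN : N ≠ 0)
    (hx : x ^ N = 1) : x = 1 := by
  obtain ⟨n, hn⟩ := h
  have h1 : nilpotentEval hn (1 + PowerSeries.X) = x := by
    rw [map_add, nilpotentEval_X, map_one, add_sub_cancel]
  have h2 : IsUnit (∑ i ∈ Finset.range N, x ^ i) := by
    have : IsUnit (∑ i ∈ Finset.range N, (1 + PowerSeries.X : PowerSeries ℚ) ^ i) := by
      rw [PowerSeries.isUnit_iff_constantCoeff]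
      simp [hN]
    simpa [h1] using this.map (nilpotentEval hn)
  have h3 := mul_geom_sum x N
  rw [hx, sub_self] at h3
  exact sub_eq_zero.1 ((h2.mul_left_eq_zero).1 h3)

/-- Both sides are commuting unipotent actions that agree at `1`. At `1/n` their quotient is
unipotent with `n`-th power `1`, hence trivial, and the `1/n` generate `ℚ`. -/
theorem unipotent_eq_nilpotentEval_binomialSeries {U : ℚ → R} (h0 : U 0 = 1)
    (hadd : ∀ q r, U (q + r) = U q * U r) {k : ℕ} (hk : ∀ q, (U q - 1) ^ k = 0) (q : ℚ) :
    U q = nilpotentEval (hk 1) (PowerSeries.binomialSeries ℚ q) := by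
  set T : ℚ → R := fun q => nilpotentEval (hk 1) (PowerSeries.binomialSeries ℚ q)
  have T0 : T 0 = 1 := by simp [T]
  have Tadd (q r) : T (q + r) = T q * T r := by simp [T]
  have npow (U : ℚ → R) (h0 : U 0 = 1) (hadd : ∀ q r, U (q + r) = U q * U r) (n : ℕ) (q : ℚ) :
      U q ^ n = U (n * q) := by
    induction n with
    | zero => simp [h0]
    | succ n ih => rw [pow_succ, ih, ← hadd]; congr 1; push_cast; ring
  have T1 : T 1 = U 1 := by
    have := PowerSeries.binomialSeries_nat (R := ℚ) (A := ℚ) 1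
    simp only [Nat.cast_one, pow_one] at this
    simp only [T, this, map_add, map_one, nilpotentEval_X]
    abel
  have comm (q r) : Commute (U q) (T r) := by
    refine Commute.nilpotentEval _ (Commute.sub_right ?_ (Commute.one_right _)) _
    rw [commute_iff_eq, ← hadd, ← hadd, add_comm]
  have nilT (q) : IsNilpotent (T q - 1) := by
    have : T q - 1 = nilpotentEval (hk 1) (PowerSeries.binomialSeries ℚ q - 1) := by simp [T]
    rw [this]
    exact isNilpotent_nilpotentEval _ (by simp)
  have key (n : ℕ) (hn : n ≠ 0) : U (n : ℚ)⁻¹ = T (n : ℚ)⁻¹ := by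
    have hn' : (n : ℚ) * (n : ℚ)⁻¹ = 1 := by field_simp
    have h1 : U (n : ℚ)⁻¹ * T (-(n : ℚ)⁻¹) = 1 := by
      refine eq_one_of_pow_eq_one_of_isNilpotent ?_ hn ?_
      · have : U (n : ℚ)⁻¹ * T (-(n : ℚ)⁻¹) - 1
            = (U (n : ℚ)⁻¹ - 1) * T (-(n : ℚ)⁻¹) + (T (-(n : ℚ)⁻¹) - 1) := by noncomm_ring
        rw [this]
        have c1 : Commute (U (n : ℚ)⁻¹ - 1) (T (-(n : ℚ)⁻¹)) :=
          (comm _ _).sub_left (Commute.one_left _)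
        refine Commute.isNilpotent_add ?_ (c1.isNilpotent_mul_right ⟨k, hk _⟩) (nilT _)
        exact (c1.mul_left (Commute.refl _)).sub_right (Commute.one_right _)
      · rw [(comm _ _).mul_pow, npow U h0 hadd, npow T T0 Tadd, mul_neg, hn', ← T1, ← Tadd,
          add_neg_cancel, T0]
    calc U (n : ℚ)⁻¹ = U (n : ℚ)⁻¹ * T (-(n : ℚ)⁻¹) * T (n : ℚ)⁻¹ := by
          rw [mul_assoc, ← Tadd, neg_add_cancel, T0, mul_one]
      _ = T (n : ℚ)⁻¹ := by rw [h1, one_mul]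
  let H : AddSubgroup ℚ :=
    { carrier := {q | U q = T q}
      zero_mem' := by simp [h0, T0]
      add_mem' := fun {a b} ha hb => by
        simp only [Set.mem_ofPred_eq] at *
        rw [hadd, Tadd, ha, hb]
      neg_mem' := fun {a} ha => by
        simp only [Set.mem_ofPred_eq] at *
        calc U (-a) = U (-a) * (T a * T (-a)) := by rw [← Tadd, add_neg_cancel, T0, mul_one]
          _ = T (-a) := by rw [← ha, ← mul_assoc, ← hadd, neg_add_cancel, h0, one_mul] }
  exact Rat.addSubgroup_eq_top (H := H) key q

end NilpotentEval

/-- The power series `((1 + X) ^ q - 1) / X`. -/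
noncomputable def binomialQuotient (q : ℚ) : PowerSeries ℚ :=
  PowerSeries.mk fun j => Ring.choose q (j + 1)

theorem X_mul_binomialQuotient (q : ℚ) :
    PowerSeries.X * binomialQuotient q = PowerSeries.binomialSeries ℚ q - 1 := by
  ext n
  cases n with
  | zero => simp
  | succ n => simp [binomialQuotient, PowerSeries.coeff_succ_X_mul, PowerSeries.coeff_one]

/-- The cocycle law satisfied by `c`, in its universal form; for natural `q` the series is the
geometric sum of the powers of `1 + X` below `q`. -/
theorem binomialQuotient_add (q r : ℚ) : binomialQuotient (q + r)
    = binomialQuotient q + PowerSeries.binomialSeries ℚ q * binomialQuotient r := by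
  refine mul_left_cancel₀ (PowerSeries.X_ne_zero (R := ℚ)) ?_
  rw [mul_add, mul_left_comm, X_mul_binomialQuotient, X_mul_binomialQuotient,
    X_mul_binomialQuotient, PowerSeries.binomialSeries_add]
  ring

theorem isUnit_binomialQuotient {q : ℚ} (hq : q ≠ 0) : IsUnit (binomialQuotient q) := by
  rw [PowerSeries.isUnit_iff_constantCoeff, ← PowerSeries.coeff_zero_eq_constantCoeff_apply]
  simpa [binomialQuotient] using hq

/-! ### Linearising the action and the cocycle on the divisible hull. -/

section DivisibleHull

variable {P : Type*} [AddCommGroup P]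

instance DivisibleHull.instCountable [Countable P] : Countable (DivisibleHull P) := by
  have : Function.Surjective (fun x : P × ℕ+ => DivisibleHull.mk x.1 x.2) := fun y => by
    induction y with | mk m s
    exact ⟨(m, s), rfl⟩
  exact this.countable

/-- The extension of an endomorphism of `P` to the divisible hull. -/
noncomputable def DivisibleHull.mapAux (f : AddMonoid.End P) : Module.End ℚ (DivisibleHull P) :=
  AddMonoidHom.toRatLinearMap
    (LocalizedModule.map (nonZeroDivisors ℕ) (AddMonoidHom.toNatLinearMap f)).toAddMonoidHom

theorem DivisibleHull.mapAux_mk (f : AddMonoid.End P) (m : P) (s : ℕ+) :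
    DivisibleHull.mapAux f (DivisibleHull.mk m s) = DivisibleHull.mk (f m) s :=
  LocalizedModule.map_mk _ _ _ _

/-- The extension of endomorphisms of `P` to the divisible hull, as a ring homomorphism. -/
noncomputable def DivisibleHull.mapEnd : AddMonoid.End P →+* Module.End ℚ (DivisibleHull P) where
  toFun := DivisibleHull.mapAux
  map_zero' := by
    ext x
    induction x with | mk m s
    rw [DivisibleHull.mapAux_mk]
    exact DivisibleHull.mk_zero s
  map_one' := by
    ext x
    induction x with | mk m s
    rw [DivisibleHull.mapAux_mk]
    rfl
  map_add' f g := by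
    ext x
    induction x with | mk m s
    rw [LinearMap.add_apply]
    simp only [DivisibleHull.mapAux_mk, DivisibleHull.mk_add_mk_left]
    rfl
  map_mul' f g := by
    ext x
    induction x with | mk m s
    rw [Module.End.mul_apply]
    simp only [DivisibleHull.mapAux_mk]
    rfl

theorem DivisibleHull.mapEnd_coe (f : AddMonoid.End P) (p : P) :
    DivisibleHull.mapEnd f (p : DivisibleHull P) = (f p : P) :=
  DivisibleHull.mapAux_mk _ _ _

/-- With `B q = ((1 + D)^q - 1)/D`, the equation `c q = A ∘ B q` prescribes `A` on the images of `P`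
under the `B (1/n)`. The prescription is consistent: a finite sum of such values can be written as
one `B (1/N) y`, with the matching sum of cocycle values equal to `c (1/N) y`, and `B (1/N)` is
injective. Divisibility of the circle then extends `A` to the whole hull. -/
theorem exists_unipotent_embedding [IsAddTorsionFree P] {k : ℕ} {u : ℚ → AddMonoid.End P}
    (h0 : u 0 = 1) (hadd : ∀ q r, u (q + r) = u q * u r) (hk : ∀ q, (u q - 1) ^ k = 0)
    {c : ℚ → P →+ UnitAddCircle} (hc : ∀ q r p, c (q + r) p = c q p + c r (u q p)) :
    ∃ (i : ℕ → P →+ DivisibleHull P) (A : DivisibleHull P →+ UnitAddCircle),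
      Function.Injective (i 0) ∧ (∀ j ≥ k, i j = 0) ∧
      (∀ q p n, i n (u q p) = ∑ m ∈ Finset.range k, Ring.choose q m • i (n + m) p) ∧
      ∀ q p, c q p = A (∑ j ∈ Finset.range k, Ring.choose q (j + 1) • i j p) := by
  set U : ℚ → Module.End ℚ (DivisibleHull P) := fun q => DivisibleHull.mapEnd (u q) with hU
  have U0 : U 0 = 1 := by simp [hU, h0]
  have Uadd (q r) : U (q + r) = U q * U r := by simp [hU, hadd]
  have Uk (q) : (U q - 1) ^ k = 0 := by
    have := congrArg DivisibleHull.mapEnd (hk q)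
    simpa using this
  have Ucoe (q) (p : P) : U q p = (u q p : P) := DivisibleHull.mapEnd_coe _ _
  have Ubin := unipotent_eq_nilpotentEval_binomialSeries U0 Uadd Uk
  set ev := nilpotentEval (Uk 1)
  set B : ℚ → Module.End ℚ (DivisibleHull P) := fun q => ev (binomialQuotient q) with hB
  have Badd (q r) : B (q + r) = B q + B r * U q := by
    simp only [hB, binomialQuotient_add, Ubin, map_add, map_mul]
    rw [← map_mul, mul_comm, map_mul]
  have Binj {q} (hq : q ≠ 0) (w) (hw : B q w = 0) : w = 0 := by
    obtain ⟨C, hC⟩ := ((isUnit_binomialQuotient hq).map ev).exists_left_inv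
    have := congrArg (fun F : Module.End ℚ (DivisibleHull P) => F w) hC
    rw [Module.End.mul_apply] at this
    change C (B q w) = w at this
    rw [← this, hw, map_zero]
  have c0 (p) : c 0 p = 0 := by simpa [h0] using hc 0 0 p
  have B0 : B 0 = 0 := by simpa [U0] using Badd 0 0
  -- The witness is `y + u r y + ⋯ + u ((m - 1) r) y`, by the cocycle law common to `B` and `c`.
  have step (m : ℕ) (r : ℚ) (y : P) :
      ∃ y' : P, B (m * r) y = B r y' ∧ c (m * r) y = c r y' := by
    induction m with
    | zero => exact ⟨0, by simp [B0, DivisibleHull.coe], by simp [c0]⟩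
    | succ m ih =>
      obtain ⟨y', h1, h2⟩ := ih
      refine ⟨y' + u (m * r) y, ?_, ?_⟩
      · rw [Nat.cast_succ, add_mul, one_mul, Badd, DivisibleHull.coe_add, map_add,
          LinearMap.add_apply, Module.End.mul_apply, Ucoe, h1]
      · rw [Nat.cast_succ, add_mul, one_mul, hc, map_add, h2]
  -- Formal sums of the prescribed values. The index `0` is harmless: `0⁻¹ = 0`, and `B 0` and `c 0`
  -- vanish.
  let f : (ℕ →₀ P) →+ DivisibleHull P := Finsupp.liftAddHom fun n =>
    (B (n : ℚ)⁻¹).toAddMonoidHom.comp (DivisibleHull.coeAddMonoidHom P)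
  let g : (ℕ →₀ P) →+ UnitAddCircle := Finsupp.liftAddHom fun n => c (n : ℚ)⁻¹
  have f_single (n : ℕ) (p : P) : f (Finsupp.single n p) = B (n : ℚ)⁻¹ p := by simp [f]
  have g_single (n : ℕ) (p : P) : g (Finsupp.single n p) = c (n : ℚ)⁻¹ p := by simp [g]
  have common (x : ℕ →₀ P) : ∃ N : ℕ, N ≠ 0 ∧ ∃ y : P,
      f x = B (N : ℚ)⁻¹ y ∧ g x = c (N : ℚ)⁻¹ y := by
    induction x using Finsupp.induction_linear with
    | zero => exact ⟨1, one_ne_zero, 0, by simp, by simp⟩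
    | single n p =>
      rw [f_single, g_single]
      rcases eq_or_ne n 0 with rfl | hn
      · exact ⟨1, one_ne_zero, 0, by simp [B0], by simp [c0]⟩
      · exact ⟨n, hn, p, rfl, rfl⟩
    | add x x' hx hx' =>
      obtain ⟨N, hN, y, h1, h2⟩ := hx
      obtain ⟨N', hN', y', h1', h2'⟩ := hx'
      obtain ⟨z, h3, h4⟩ := step N' ((N * N' : ℕ) : ℚ)⁻¹ y
      obtain ⟨z', h3', h4'⟩ := step N ((N * N' : ℕ) : ℚ)⁻¹ y'
      have e : (N' : ℚ) * ((N * N' : ℕ) : ℚ)⁻¹ = (N : ℚ)⁻¹ := by push_cast; field_simp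
      have e' : (N : ℚ) * ((N * N' : ℕ) : ℚ)⁻¹ = (N' : ℚ)⁻¹ := by push_cast; field_simp
      rw [e] at h3 h4
      rw [e'] at h3' h4'
      refine ⟨N * N', mul_ne_zero hN hN', z + z', ?_, ?_⟩
      · rw [map_add, h1, h1', h3, h3', DivisibleHull.coe_add, map_add]
      · rw [map_add, h2, h2', h4, h4', map_add]
  obtain ⟨A, hA⟩ := UnitAddCircle.exists_extension f g fun x hx => by
    obtain ⟨N, hN, y, h1, h2⟩ := common x
    have h3 : (y : DivisibleHull P) = 0 := Binj (by simpa using hN) _ (h1.symm.trans hx)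
    have h4 : y = 0 := DivisibleHull.coe_injective (h3.trans (DivisibleHull.mk_zero 1).symm)
    rw [h2, h4, map_zero]
  have hcA (q : ℚ) : ∀ p : P, c q p = A (B q p) := by
    let H : AddSubgroup ℚ :=
      { carrier := {q | ∀ p : P, c q p = A (B q p)}
        zero_mem' := fun p => by simp [B0, c0]
        add_mem' := fun {a b} ha hb p => by
          rw [hc, ha p, hb, Badd, LinearMap.add_apply, map_add, Module.End.mul_apply, Ucoe]
        neg_mem' := fun {a} ha p => by
          have e1 := hc (-a) a p
          have e2 := Badd (-a) a
          rw [neg_add_cancel, c0, ha, ← Ucoe, ← Module.End.mul_apply] at e1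
          rw [neg_add_cancel, B0] at e2
          rw [eq_neg_of_add_eq_zero_left e1.symm, eq_neg_of_add_eq_zero_left e2.symm,
            LinearMap.neg_apply, map_neg] }
    refine Rat.addSubgroup_eq_top (H := H) (fun n _ p => ?_) q
    rw [← f_single, hA, g_single]
  -- The maps are `i j = D^j` restricted to `P`.
  refine ⟨fun j => ((U 1 - 1) ^ j).toAddMonoidHom.comp (DivisibleHull.coeAddMonoidHom P), A,
    ?_, ?_, ?_, ?_⟩
  · intro p p' h
    exact DivisibleHull.coe_injective (by simpa using h)
  · intro j hj
    ext p
    simp [pow_eq_zero_of_le hj (Uk 1)]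
  · intro q p n
    have : (U 1 - 1) ^ n * U q
        = ∑ m ∈ Finset.range k, Ring.choose q m • (U 1 - 1) ^ (n + m) := by
      rw [Ubin q, nilpotentEval_apply, Finset.mul_sum]
      simp [pow_add]
    have := congrArg (fun F : Module.End ℚ (DivisibleHull P) => F p) this
    simpa [Ucoe] using this
  · intro q p
    rw [hcA]
    congr 1
    simp [hB, ev, nilpotentEval_apply, binomialQuotient]

end DivisibleHull

/-- The standard embedding of `ℝ / ℤ` as the unit circle of `ℂ`. -/
noncomputable def unitPhase (t : UnitAddCircle) : ℂ := (AddCircle.toCircle t : ℂ)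

theorem continuous_unitPhase : Continuous unitPhase :=
  continuous_subtype_val.comp AddCircle.continuous_toCircle

theorem unitPhase_injective : Function.Injective unitPhase :=
  Subtype.val_injective.comp (AddCircle.injective_toCircle one_ne_zero)

@[simp] theorem unitPhase_zero : unitPhase 0 = 1 := by simp [unitPhase]

theorem unitPhase_add (s t : UnitAddCircle) : unitPhase (s + t) = unitPhase s * unitPhase t := by
  simp [unitPhase, AddCircle.toCircle_add]

theorem unitPhase_neg (t : UnitAddCircle) : unitPhase (-t) = conj (unitPhase t) := by
  rw [unitPhase, AddCircle.toCircle_neg, Circle.coe_inv_eq_conj, unitPhase]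

theorem unitPhase_sub (s t : UnitAddCircle) :
    unitPhase (s - t) = conj (unitPhase t) * unitPhase s := by
  rw [sub_eq_add_neg, unitPhase_add, unitPhase_neg, mul_comm]

@[simp] theorem norm_unitPhase (t : UnitAddCircle) : ‖unitPhase t‖ = 1 :=
  Circle.norm_coe _

theorem exists_unitPhase_eq {z : ℂ} (hz : ‖z‖ = 1) : ∃ t, unitPhase t = z := by
  let c : Circle := ⟨z, show z ∈ Submonoid.unitSphere ℂ from mem_sphere_zero_iff_norm.2 hz⟩
  refine ⟨(AddCircle.homeomorphCircle one_ne_zero).symm c, ?_⟩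
  rw [unitPhase, ← AddCircle.homeomorphCircle_apply one_ne_zero, Homeomorph.apply_symm_apply]

theorem exists_measurable_unitPhase_leftInverse :
    ∃ r : ℂ → UnitAddCircle, Measurable r ∧ ∀ t, r (unitPhase t) = t := by
  obtain ⟨r, hr, h⟩ := (continuous_unitPhase.measurableEmbedding
    unitPhase_injective).exists_measurable_extend measurable_id fun _ => inferInstance
  exact ⟨r, hr, congrFun h⟩

/-- Orthonormal vectors lie at distance `√2`, so balls of radius `1/2` about them are disjoint. -/
theorem Orthonormal.countable {𝕜 E ι : Type*} [RCLike 𝕜] [NormedAddCommGroup E]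
    [InnerProductSpace 𝕜 E] [TopologicalSpace.SeparableSpace E] {f : ι → E}
    (hf : Orthonormal 𝕜 f) : Countable ι := by
  have : (Set.univ : Set ι).PairwiseDisjoint fun i => Metric.ball (f i) (1 / 2) := by
    intro i _ j _ hij
    refine Metric.ball_disjoint_ball ?_
    have h : ‖f i - f j‖ ^ 2 = 2 := by
      rw [@norm_sub_sq 𝕜, hf.1, hf.1, hf.2 hij]
      norm_num
    rw [dist_eq_norm]
    nlinarith [norm_nonneg (f i - f j)]
  rw [← Set.countable_univ_iff]
  exact this.countable_of_isOpen (fun _ _ => Metric.isOpen_ball) fun i _ =>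
    ⟨f i, Metric.mem_ball_self (by norm_num)⟩

/-! ### Phase polynomials of an ergodic system. -/

namespace QSystem

variable (X : QSystem.{u})

/-- Measurable functions `X → ℝ / ℤ` modulo almost everywhere equality. -/
abbrev AngleFun : Type u := X →ₘ[X.μ] UnitAddCircle

/-- The action `g ↦ g ∘ T^q` on functions `X → ℝ / ℤ`. -/
noncomputable def koopman (q : ℚ) : X.AngleFun →+ X.AngleFun where
  toFun g := g.compMeasurePreserving (q +ᵥ ·) (measurePreserving_vadd q X.μ)
  map_zero' := rfl
  map_add' f g := by
    induction f using AEEqFun.induction_on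
    induction g using AEEqFun.induction_on
    rfl

theorem coeFn_koopman (q : ℚ) (g : X.AngleFun) :
    X.koopman q g =ᵐ[X.μ] fun x => g (q +ᵥ x) :=
  g.coeFn_compMeasurePreserving (measurePreserving_vadd q X.μ)

theorem ae_vadd {p : X → Prop} (h : ∀ᵐ x ∂X.μ, p x) (q : ℚ) : ∀ᵐ x ∂X.μ, p (q +ᵥ x) :=
  (measurePreserving_vadd q X.μ).quasiMeasurePreserving.ae h

theorem koopman_zero (g : X.AngleFun) : X.koopman 0 g = g := by
  refine AEEqFun.ext ?_
  filter_upwards [X.coeFn_koopman 0 g] with x hx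
  rw [hx, zero_vadd]

theorem koopman_add (q r : ℚ) (g : X.AngleFun) :
    X.koopman (q + r) g = X.koopman q (X.koopman r g) := by
  refine AEEqFun.ext ?_
  filter_upwards [X.coeFn_koopman (q + r) g, X.coeFn_koopman q (X.koopman r g),
    X.ae_vadd (X.coeFn_koopman r g) q] with x h1 h2 h3
  rw [h1, h2, h3, vadd_vadd, add_comm]

/-- Constant functions. -/
noncomputable def constHom : UnitAddCircle →+ X.AngleFun where
  toFun t := AEEqFun.const X t
  map_zero' := rfl
  map_add' _ _ := rfl

theorem coeFn_constHom (t : UnitAddCircle) : X.constHom t =ᵐ[X.μ] fun _ => t :=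
  AEEqFun.coeFn_const X t

theorem constHom_injective : Function.Injective X.constHom := by
  intro s t h
  obtain ⟨x, hx⟩ := ((X.coeFn_constHom s).symm.trans (h ▸ X.coeFn_constHom t)).exists
  exact hx

@[simp] theorem koopman_constHom (q : ℚ) (t : UnitAddCircle) :
    X.koopman q (X.constHom t) = X.constHom t := rfl

/-- The filtration of the group of functions `X → ℝ / ℤ` by polynomial degree:
`polyFiltration (n + 1)` consists of the polynomials of degree at most `n`. -/
noncomputable def polyFiltration : ℕ → AddSubgroup X.AngleFun
  | 0 => ⊥
  | n + 1 => ⨅ q : ℚ, (polyFiltration n).comap (X.koopman q - AddMonoidHom.id _)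

theorem mem_polyFiltration_succ {n : ℕ} {g : X.AngleFun} :
    g ∈ X.polyFiltration (n + 1) ↔ ∀ q, X.koopman q g - g ∈ X.polyFiltration n := by
  simp [polyFiltration, AddSubgroup.mem_iInf]

theorem constHom_mem (n : ℕ) (t : UnitAddCircle) : X.constHom t ∈ X.polyFiltration (n + 1) := by
  rw [mem_polyFiltration_succ]
  simp

theorem koopman_mem {n : ℕ} {g : X.AngleFun} (hg : g ∈ X.polyFiltration n) (q : ℚ) :
    X.koopman q g ∈ X.polyFiltration n := by
  induction n generalizing g with
  | zero =>
    have : g = 0 := hg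
    rw [this, map_zero]
    exact zero_mem _
  | succ n ih =>
    rw [mem_polyFiltration_succ] at hg ⊢
    intro r
    rw [← koopman_add, add_comm, koopman_add, ← map_sub]
    exact ih (hg r)

variable {X}

theorem eq_constHom_of_invariant (hX : X.IsErgodic) {g : X.AngleFun}
    (hg : ∀ q, X.koopman q g = g) : ∃ t, g = X.constHom t := by
  have := hX
  unfold IsErgodic at this
  obtain ⟨t, ht⟩ := Filter.exists_eventuallyEq_const_of_forall_separating (l := ae X.μ) (f := g)
    MeasurableSet fun U hU => by
      refine Filter.eventuallyConst_set.1 (aeconst_of_forall_preimage_vadd_ae_eq ℚ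
        (s := g ⁻¹' U) ((g.measurable hU).nullMeasurableSet) fun q => ?_)
      filter_upwards [X.coeFn_koopman q g] with x hx
      rw [hg q] at hx
      apply propext
      change g (q +ᵥ x) ∈ U ↔ g x ∈ U
      rw [hx]
  exact ⟨t, AEEqFun.ext (ht.trans (X.coeFn_constHom t).symm)⟩

theorem eq_constHom_of_mem_one (hX : X.IsErgodic) {g : X.AngleFun}
    (hg : g ∈ X.polyFiltration 1) : ∃ t, g = X.constHom t :=
  eq_constHom_of_invariant hX fun q => sub_eq_zero.1 (X.mem_polyFiltration_succ.1 hg q)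

/-- Makes `P` torsion-free. By induction on the degree each derivative of `g` is a constant killed
by `N`. Since `q` is `N` times `q / N`, the derivative along `q` is `N` times the one along `q / N`,
hence zero. -/
theorem eq_constHom_of_nsmul (hX : X.IsErgodic) {n : ℕ} {g : X.AngleFun}
    (hg : g ∈ X.polyFiltration n) {N : ℕ} (hN : N ≠ 0) {t : UnitAddCircle}
    (h : N • g = X.constHom t) : ∃ s, g = X.constHom s := by
  induction n generalizing g t with
  | zero => exact ⟨0, hg⟩
  | succ n ih =>
    rw [mem_polyFiltration_succ] at hg
    have h1 (q) : N • (X.koopman q g - g) = 0 := by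
      rw [smul_sub, ← map_nsmul, h, koopman_constHom, sub_self]
    have h2 (q) : ∃ s, X.koopman q g - g = X.constHom s :=
      ih (hg q) (t := 0) (by rw [h1, map_zero])
    choose s hs using h2
    have h3 (q : ℚ) (m : ℕ) : X.koopman (m * q) g = g + m • X.constHom (s q) := by
      induction m with
      | zero => simp [koopman_zero]
      | succ m ih =>
        have : X.koopman q g = g + X.constHom (s q) := by rw [← hs]; abel
        rw [Nat.cast_succ, add_mul, one_mul, add_comm, koopman_add, ih, map_add, map_nsmul,
          koopman_constHom, this, succ_nsmul]
        abel
    refine eq_constHom_of_invariant hX fun q => ?_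
    have h4 := h3 (q / N) N
    rwa [mul_div_cancel₀ _ (by simpa using hN), ← hs, h1, add_zero] at h4

/-- The integral of the phase function attached to `g`. -/
noncomputable def phaseIntegral (g : X.AngleFun) : ℂ := ∫ x, unitPhase (g x) ∂X.μ

theorem phaseIntegral_koopman (q : ℚ) (g : X.AngleFun) :
    phaseIntegral (X.koopman q g) = phaseIntegral g := by
  have h1 : phaseIntegral (X.koopman q g) = ∫ x, unitPhase (g (q +ᵥ x)) ∂X.μ := by
    refine integral_congr_ae ?_
    filter_upwards [X.coeFn_koopman q g] with x hx
    rw [hx]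
  rw [h1]
  exact (measurePreserving_vadd q X.μ).integral_comp
    (measurableEmbedding_const_vadd q) fun x => unitPhase (g x)

theorem phaseIntegral_add_constHom (g : X.AngleFun) (t : UnitAddCircle) :
    phaseIntegral (g + X.constHom t) = unitPhase t * phaseIntegral g := by
  rw [phaseIntegral, phaseIntegral, ← integral_const_mul]
  refine integral_congr_ae ?_
  filter_upwards [AEEqFun.coeFn_add g (X.constHom t), X.coeFn_constHom t] with x h1 h2
  rw [h1, Pi.add_apply, h2, unitPhase_add, mul_comm]

theorem phaseIntegral_neg (g : X.AngleFun) : phaseIntegral (-g) = conj (phaseIntegral g) := by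
  rw [phaseIntegral, phaseIntegral, ← integral_conj]
  refine integral_congr_ae ?_
  filter_upwards [AEEqFun.coeFn_neg g] with x h1
  rw [h1, Pi.neg_apply, unitPhase_neg]

theorem memLp_unitPhase (g : X.AngleFun) (p : ENNReal) :
    MemLp (fun x => unitPhase (g x)) p X.μ :=
  MemLp.of_bound (continuous_unitPhase.comp_aestronglyMeasurable g.aestronglyMeasurable) 1
    (by simp)

/-- The phase function attached to `g` as an element of `L²`. -/
noncomputable def phaseLp (g : X.AngleFun) : Lp ℂ 2 X.μ := (memLp_unitPhase g 2).toLp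

theorem coeFn_phaseLp (g : X.AngleFun) : phaseLp g =ᵐ[X.μ] fun x => unitPhase (g x) :=
  MemLp.coeFn_toLp _

theorem inner_phaseLp (g h : X.AngleFun) :
    inner ℂ (phaseLp g) (phaseLp h) = phaseIntegral (h - g) := by
  rw [L2.inner_def, phaseIntegral]
  refine integral_congr_ae ?_
  filter_upwards [AEEqFun.coeFn_sub h g, coeFn_phaseLp g, coeFn_phaseLp h] with x h1 h2 h3
  rw [h1, h2, h3, Pi.sub_apply, unitPhase_sub, RCLike.inner_apply, mul_comm]

theorem norm_phaseLp (g : X.AngleFun) : ‖phaseLp g‖ = 1 := by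
  have h := inner_self_eq_norm_sq_to_K (𝕜 := ℂ) (phaseLp g)
  have h0 : phaseIntegral (0 : X.AngleFun) = 1 := by
    have : phaseIntegral (0 : X.AngleFun) = ∫ _, (1 : ℂ) ∂X.μ := by
      refine integral_congr_ae ?_
      filter_upwards [X.coeFn_constHom 0] with x h
      rw [← map_zero X.constHom, h, unitPhase_zero]
    simpa using this
  rw [inner_phaseLp, sub_self, h0] at h
  have h' : ‖phaseLp g‖ ^ 2 = 1 := by
    have := congrArg norm h.symm
    simpa using this
  exact (pow_eq_one_iff_of_nonneg (norm_nonneg _) two_ne_zero).1 h'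

/-- Induction on the degree, via the group `H` of those `q` whose derivative of `g` is constant. If
`H = ℚ`, the phase is an eigenfunction; as `g` is not constant, some eigenvalue differs from `1` and
invariance kills the integral. Otherwise the translates of the phase over the cosets of `H` are
orthonormal by induction, infinite in number, and have inner products with `1` of equal modulus, so
Bessel's inequality forces zero. -/
theorem phaseIntegral_eq_zero (hX : X.IsErgodic) {n : ℕ} {g : X.AngleFun}
    (hg : g ∈ X.polyFiltration n) (h : ∀ t, g ≠ X.constHom t) : phaseIntegral g = 0 := by
  induction n generalizing g with
  | zero => exact absurd (show g = X.constHom 0 from hg) (h 0)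
  | succ n ih =>
    rw [mem_polyFiltration_succ] at hg
    let H : AddSubgroup ℚ :=
      { carrier := {q | ∃ t, X.koopman q g - g = X.constHom t}
        zero_mem' := ⟨0, by simp [koopman_zero]⟩
        add_mem' := fun {a b} ⟨s, hs⟩ ⟨t, ht⟩ => ⟨s + t, by
          rw [map_add, ← hs, koopman_add, sub_eq_iff_eq_add.1 ht, map_add, koopman_constHom]
          abel⟩
        neg_mem' := fun {a} ⟨s, hs⟩ => ⟨-s, by
          have := congrArg (X.koopman (-a)) hs
          rw [map_sub, ← koopman_add, neg_add_cancel, koopman_zero, koopman_constHom] at this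
          rw [map_neg, ← this, neg_sub]⟩ }
    by_cases hH : ∀ q, q ∈ H
    · choose t ht using hH
      by_cases h0 : ∀ q, t q = 0
      · obtain ⟨s, hs⟩ := eq_constHom_of_invariant hX (g := g) fun q => by
          rw [← sub_eq_zero, ht, h0, map_zero]
        exact absurd hs (h s)
      · push Not at h0
        obtain ⟨q, hq⟩ := h0
        have h1 := phaseIntegral_koopman q g
        rw [sub_eq_iff_eq_add'.1 (ht q), phaseIntegral_add_constHom] at h1
        have h2 : unitPhase (t q) ≠ 1 := fun h => hq (unitPhase_injective (by simpa using h))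
        by_contra h3
        exact h2 (mul_right_cancel₀ h3 (by rw [h1, one_mul]))
    -- A divisible group has no proper subgroup of finite index.
    · have : Infinite (ℚ ⧸ H) := by
        by_contra hfin
        rw [not_infinite_iff_finite] at hfin
        have hi := AddSubgroup.index_ne_zero_of_finite (H := H)
        refine hH fun q => ?_
        have := AddSubgroup.nsmul_index_mem H (q / H.index)
        rwa [nsmul_eq_mul, mul_div_cancel₀ _ (by simpa using hi)] at this
      have hort : Orthonormal ℂ fun c : ℚ ⧸ H => phaseLp (X.koopman c.out g) := by
        refine ⟨fun c => norm_phaseLp _, fun c c' hc => ?_⟩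
        change inner ℂ (phaseLp (X.koopman c.out g)) (phaseLp (X.koopman c'.out g)) = 0
        rw [inner_phaseLp]
        have e : X.koopman c'.out g - X.koopman c.out g
            = X.koopman c.out (X.koopman (-c.out + c'.out) g - g) := by
          rw [map_sub, ← koopman_add, add_neg_cancel_left]
        rw [e, phaseIntegral_koopman]
        refine ih (hg _) fun t ht => hc ?_
        rw [← QuotientAddGroup.out_eq' c, ← QuotientAddGroup.out_eq' c', QuotientAddGroup.eq]
        exact ⟨t, ht⟩
      have hs := hort.inner_products_summable (phaseLp (0 : X.AngleFun))
      have e (q : ℚ) : ‖inner ℂ (phaseLp (X.koopman q g)) (phaseLp 0)‖ ^ 2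
          = ‖phaseIntegral g‖ ^ 2 := by
        rw [inner_phaseLp, zero_sub, phaseIntegral_neg, phaseIntegral_koopman, RCLike.norm_conj]
      simp only [e] at hs
      rw [summable_const_iff] at hs
      simpa using hs

/-- Zero shifts turn the defining equation of a phase polynomial into `|f|^(2^(k+1)) = 1`, so `f`
takes values in the circle. -/
theorem norm_iterMulDeriv_zero (n : ℕ) (f : X → ℂ) (x : X) :
    ‖X.iterMulDeriv n 0 f x‖ = ‖f x‖ ^ 2 ^ n := by
  induction n with
  | zero => simp [iterMulDeriv]
  | succ n ih =>
    have ih' : ‖X.iterMulDeriv n (fun _ => 0) f x‖ = ‖f x‖ ^ 2 ^ n := ih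
    simp only [iterMulDeriv, mulDeriv, Pi.zero_apply, zero_vadd, norm_mul, RCLike.norm_conj, ih']
    rw [← pow_add, ← two_mul, pow_succ']

theorem IsPhasePolynomial.norm_eq_one {k : ℕ} {f : X → ℂ} (hf : X.IsPhasePolynomial k f) :
    ∀ᵐ x ∂X.μ, ‖f x‖ = 1 := by
  filter_upwards [hf.2 0] with x hx
  have := norm_iterMulDeriv_zero (k + 1) f x
  rw [hx, norm_one] at this
  exact (pow_eq_one_iff_of_nonneg (norm_nonneg _) (by positivity)).1 this.symm

/-- `iterMulDeriv` peels off the outermost derivative, `polyFiltration` the innermost; this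
reconciles them. -/
theorem iterMulDeriv_cons (n : ℕ) (q : ℚ) (r : Fin n → ℚ) (f : X → ℂ) :
    X.iterMulDeriv (n + 1) (Fin.cons q r) f = X.iterMulDeriv n r (X.mulDeriv q f) := by
  induction n with
  | zero => rfl
  | succ n ih =>
    have e : (fun i : Fin (n + 1) => (Fin.cons q r : Fin (n + 2) → ℚ) i.castSucc)
        = Fin.cons q fun i => r i.castSucc := by
      funext i
      refine Fin.cases ?_ (fun j => ?_) i
      · rfl
      · simp
    rw [iterMulDeriv, e, ih]
    rfl

theorem mem_polyFiltration_of_iterMulDeriv {n : ℕ} {f : X → ℂ} {g : X.AngleFun}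
    (hfg : f =ᵐ[X.μ] fun x => unitPhase (g x))
    (h : ∀ q : Fin n → ℚ, X.iterMulDeriv n q f =ᵐ[X.μ] fun _ => 1) :
    g ∈ X.polyFiltration n := by
  induction n generalizing f g with
  | zero =>
    change g = X.constHom 0
    refine AEEqFun.ext ?_
    filter_upwards [h Fin.elim0, hfg, X.coeFn_constHom 0] with x h1 h2 h3
    rw [h3]
    refine unitPhase_injective ?_
    rw [← h2, unitPhase_zero]
    exact h1
  | succ n ih =>
    rw [mem_polyFiltration_succ]
    intro q
    refine ih (f := X.mulDeriv q f) ?_ fun r => ?_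
    · filter_upwards [hfg, X.ae_vadd hfg q, X.coeFn_koopman q g,
        AEEqFun.coeFn_sub (X.koopman q g) g] with x h1 h2 h3 h4
      rw [h4, Pi.sub_apply, h3, unitPhase_sub, mulDeriv, h1, h2]
    · rw [← iterMulDeriv_cons]
      exact h _

theorem IsPhasePolynomial.exists_mem_polyFiltration {k : ℕ} {f : X → ℂ}
    (hf : X.IsPhasePolynomial k f) :
    ∃ g ∈ X.polyFiltration (k + 1), f =ᵐ[X.μ] fun x => unitPhase (g x) := by
  obtain ⟨r, hr, hr'⟩ := exists_measurable_unitPhase_leftInverse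
  have hm : AEStronglyMeasurable (fun x => r (f x)) X.μ :=
    (hr.comp_aemeasurable hf.1.aestronglyMeasurable.aemeasurable).aestronglyMeasurable
  have h : f =ᵐ[X.μ] fun x => unitPhase (AEEqFun.mk _ hm x) := by
    filter_upwards [hf.norm_eq_one, AEEqFun.coeFn_mk _ hm] with x h1 h2
    obtain ⟨t, ht⟩ := exists_unitPhase_eq h1
    rw [h2, ← ht, hr']
  exact ⟨_, mem_polyFiltration_of_iterMulDeriv h hf.2, h⟩

instance : TopologicalSpace.SeparableSpace (Lp ℂ 2 X.μ) := by
  let := TopologicalSpace.metrizableSpaceMetric X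
  have : PolishSpace X := inferInstance
  have : Fact ((2 : ENNReal) ≠ ⊤) := ⟨by simp⟩
  infer_instance

end QSystem

namespace QSystem

variable {X : QSystem.{u}}

/-- The structure of the group of phase polynomials of an ergodic system: it splits as the sum of
the constants and a countable torsion-free group `P`, on which `ℚ` acts unipotently up to
constants. -/
theorem exists_polynomial_group (hX : X.IsErgodic) (k : ℕ) :
    ∃ (P : Type) (_ : AddCommGroup P) (_ : Countable P) (_ : IsAddTorsionFree P)
      (s : P →+ X.AngleFun) (u : ℚ → AddMonoid.End P) (c : ℚ → P →+ UnitAddCircle),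
      u 0 = 1 ∧ (∀ q r, u (q + r) = u q * u r) ∧ (∀ q, (u q - 1) ^ k = 0) ∧
      (∀ q r p, c (q + r) p = c q p + c r (u q p)) ∧
      (∀ q p, X.koopman q (s p) = s (u q p) + X.constHom (c q p)) ∧
      (∀ p, p ≠ 0 → phaseIntegral (s p) = 0) ∧
      ∀ g ∈ X.polyFiltration (k + 1), ∃ p t, g = s p + X.constHom t := by
  -- A retraction onto the constants; its kernel supplies the complement `K`.
  obtain ⟨ρ, hρ⟩ := UnitAddCircle.exists_extension X.constHom (AddMonoidHom.id _) fun t ht =>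
    X.constHom_injective (ht.trans (map_zero _).symm)
  simp only [AddMonoidHom.id_apply] at hρ
  set K : AddSubgroup X.AngleFun := X.polyFiltration (k + 1) ⊓ ρ.ker
  have K_mem {g : X.AngleFun} (hg : g ∈ X.polyFiltration (k + 1)) :
      g - X.constHom (ρ g) ∈ K := by
    refine ⟨(X.polyFiltration _).sub_mem hg (X.constHom_mem _ _), ?_⟩
    change ρ _ = 0
    rw [map_sub, hρ, sub_self]
  have K_zero {g : X.AngleFun} (hg : g ∈ K) {t : UnitAddCircle} (h : g = X.constHom t) :
      g = 0 := by
    have h1 : ρ g = 0 := hg.2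
    rw [h, hρ] at h1
    rw [h, h1, map_zero]
  have K_int {g : X.AngleFun} (hg : g ∈ K) (h0 : g ≠ 0) : phaseIntegral g = 0 :=
    phaseIntegral_eq_zero hX hg.1 fun t ht => h0 (K_zero hg ht)
  have hcount : Countable K := by
    have : Orthonormal ℂ fun g : K => phaseLp (g : X.AngleFun) := by
      refine ⟨fun g => norm_phaseLp _, fun g h hgh => ?_⟩
      change inner ℂ (phaseLp (g : X.AngleFun)) (phaseLp (h : X.AngleFun)) = 0
      rw [inner_phaseLp]
      exact K_int (K.sub_mem h.2 g.2) fun e => hgh (Subtype.ext (sub_eq_zero.1 e).symm)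
    exact this.countable
  -- Countability of `K` moves it to universe `0`, whatever the universe of `X`.
  let P := Shrink.{0} K
  let e : P ≃+ K := Shrink.addEquiv
  let s : P →+ X.AngleFun := K.subtype.comp e.toAddMonoidHom
  have s_inj : Function.Injective s := Subtype.val_injective.comp e.injective
  have s_mem (p : P) : s p ∈ K := (e p).2
  have s_surj {g} (hg : g ∈ K) : ∃ p, s p = g := ⟨e.symm ⟨g, hg⟩, by simp [s]⟩
  have s_ker (p : P) : ρ (s p) = 0 := (s_mem p).2
  choose u' hu' using fun (q : ℚ) (p : P) => s_surj (K_mem (X.koopman_mem (s_mem p).1 q))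
  let u (q : ℚ) : AddMonoid.End P :=
    { toFun := u' q
      map_zero' := s_inj (by rw [hu']; simp)
      map_add' := fun p p' => s_inj (by simp only [hu', map_add]; abel) }
  let c (q : ℚ) : P →+ UnitAddCircle := ρ.comp ((X.koopman q).comp s)
  have hu (q : ℚ) (p : P) : X.koopman q (s p) = s (u q p) + X.constHom (c q p) := by
    change _ = s (u' q p) + X.constHom (ρ (X.koopman q (s p)))
    rw [hu', sub_add_cancel]
  have hc (q : ℚ) (p : P) : c q p = ρ (X.koopman q (s p)) := rfl
  have c_add (q r : ℚ) (p : P) : c (q + r) p = c q p + c r (u q p) := by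
    rw [hc, add_comm, koopman_add, hu, map_add, map_add, koopman_constHom, hρ, ← hc, add_comm]
  refine ⟨P, inferInstance, e.injective.countable, ?_, s, u, c, ?_, ?_, ?_, c_add, hu, ?_, ?_⟩
  · refine ⟨fun n hn p p' h => ?_⟩
    have h1 : n • (s (p - p')) = X.constHom 0 := by
      rw [← map_nsmul, smul_sub, sub_eq_zero.2 h, map_zero, map_zero]
    obtain ⟨t, ht⟩ := eq_constHom_of_nsmul hX (s_mem _).1 hn h1
    have h2 := K_zero (s_mem _) ht
    rw [map_sub, sub_eq_zero] at h2
    exact s_inj h2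
  · refine AddMonoidHom.ext fun p => ?_
    refine s_inj ?_
    have := hu 0 p
    rw [hc, koopman_zero, s_ker, map_zero, add_zero] at this
    exact this.symm
  · intro q r
    refine AddMonoidHom.ext fun p => ?_
    refine s_inj ?_
    have h1 := hu (q + r) p
    rw [koopman_add, hu r, map_add, koopman_constHom, hu q, add_comm q r, c_add, map_add,
      add_assoc, add_comm (X.constHom (c r p)), add_left_inj] at h1
    rw [add_comm q r]
    exact h1.symm
  · intro q
    -- `u q - 1` lowers the degree by one, and a constant lying in `K` is zero.
    have key (j : ℕ) (hj : j ≤ k) (p : P) (hp : s p ∈ X.polyFiltration (j + 1)) :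
        ((u q - 1) ^ j) p = 0 := by
      induction j generalizing p with
      | zero =>
        obtain ⟨t, ht⟩ := eq_constHom_of_mem_one hX hp
        exact s_inj ((K_zero (s_mem _) ht).trans (map_zero s).symm)
      | succ j ih =>
        rw [pow_succ]
        refine ih (by omega) ((u q - 1) p) ?_
        have h1 : s ((u q - 1) p) = (X.koopman q (s p) - s p) - X.constHom (c q p) := by
          rw [hu]
          change s (u q p - p) = _
          rw [map_sub]
          abel
        rw [h1]
        exact (X.polyFiltration _).sub_mem (X.mem_polyFiltration_succ.1 hp q) (X.constHom_mem _ _)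
    refine AddMonoidHom.ext fun p => ?_
    exact key k le_rfl p (s_mem p).1
  · exact fun p hp => K_int (s_mem p) fun h => hp (s_inj (h.trans (map_zero s).symm))
  · intro g hg
    obtain ⟨p, hp⟩ := s_surj (K_mem hg)
    exact ⟨p, ρ g, by rw [hp, sub_add_cancel]⟩

end QSystem

/-! ### The compact dual of a discrete group. -/

/-- The group of characters `W → ℝ / ℤ` of a discrete abelian group `W`, with the topology of
pointwise convergence. -/
def CharGroup (W : Type w) [AddCommGroup W] : Type w := W →+ UnitAddCircle

namespace CharGroup

variable {W : Type w} [AddCommGroup W]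

noncomputable instance : AddCommGroup (CharGroup W) :=
  inferInstanceAs (AddCommGroup (W →+ UnitAddCircle))

instance : FunLike (CharGroup W) W UnitAddCircle :=
  inferInstanceAs (FunLike (W →+ UnitAddCircle) W UnitAddCircle)

instance : AddMonoidHomClass (CharGroup W) W UnitAddCircle :=
  inferInstanceAs (AddMonoidHomClass (W →+ UnitAddCircle) W UnitAddCircle)

@[ext] theorem ext {x y : CharGroup W} (h : ∀ w, x w = y w) : x = y := DFunLike.ext _ _ h

/-- An additive homomorphism as an element of `CharGroup W`. -/
def ofHom (f : W →+ UnitAddCircle) : CharGroup W := f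

/-- An element of `CharGroup W` as an additive homomorphism. -/
def toHom (x : CharGroup W) : W →+ UnitAddCircle := x

@[simp] theorem toHom_apply (x : CharGroup W) (w : W) : x.toHom w = x w := rfl

@[simp] theorem ofHom_apply (f : W →+ UnitAddCircle) (w : W) : ofHom f w = f w := rfl

@[simp] theorem zero_apply (w : W) : (0 : CharGroup W) w = 0 := rfl

@[simp] theorem add_apply (x y : CharGroup W) (w : W) : (x + y) w = x w + y w := rfl

instance : TopologicalSpace (CharGroup W) :=
  TopologicalSpace.induced (fun x : CharGroup W => (x : W → UnitAddCircle)) inferInstance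

instance : IsTopologicalAddGroup (CharGroup W) :=
  topologicalAddGroup_induced (AddMonoidHom.coeFn W UnitAddCircle)

theorem isClosedEmbedding_coe :
    Topology.IsClosedEmbedding fun x : CharGroup W => (x : W → UnitAddCircle) := by
  refine ⟨⟨⟨rfl⟩, DFunLike.coe_injective⟩, ?_⟩
  have : Set.range (fun x : CharGroup W => (x : W → UnitAddCircle))
      = ⋂ (v : W) (w : W), {f | f (v + w) = f v + f w} := by
    ext f
    simp only [Set.mem_range, Set.mem_iInter, Set.mem_ofPred_eq]
    refine ⟨?_, fun h => ⟨ofHom (AddMonoidHom.mk' f h), rfl⟩⟩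
    rintro ⟨x, rfl⟩ v w
    exact map_add x v w
  rw [this]
  exact isClosed_iInter fun v => isClosed_iInter fun w => isClosed_eq (by fun_prop) (by fun_prop)

instance : CompactSpace (CharGroup W) := isClosedEmbedding_coe.compactSpace

instance : T2Space (CharGroup W) := isClosedEmbedding_coe.isEmbedding.t2Space

instance [Countable W] : SecondCountableTopology (CharGroup W) :=
  isClosedEmbedding_coe.isEmbedding.secondCountableTopology

instance [Countable W] : TopologicalSpace.MetrizableSpace (CharGroup W) :=
  TopologicalSpace.metrizableSpace_of_t3_secondCountable _

instance : MeasurableSpace (CharGroup W) := borel _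

instance : BorelSpace (CharGroup W) := ⟨rfl⟩

theorem continuous_apply (w : W) : Continuous fun x : CharGroup W => x w :=
  (_root_.continuous_apply w).comp isClosedEmbedding_coe.continuous

theorem continuous_of_apply {Y : Type*} [TopologicalSpace Y] {f : Y → CharGroup W}
    (h : ∀ w, Continuous fun y => f y w) : Continuous f :=
  isClosedEmbedding_coe.isEmbedding.continuous_iff.2 (continuous_pi h)

theorem measurable_of_apply [Countable W] {Y : Type*} [MeasurableSpace Y] {f : Y → CharGroup W}
    (h : ∀ w, Measurable fun y => f y w) : Measurable f :=
  isClosedEmbedding_coe.measurableEmbedding.measurable_comp_iff.1 (measurable_pi_lambda _ h)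

/-- Since `w` has infinite order, a character of `ℤw` may take any value at `w`; the nonzero value
chosen has phase `-1`. -/
theorem exists_apply_ne_zero [IsAddTorsionFree W] {w : W} (hw : w ≠ 0) :
    ∃ x : CharGroup W, x w ≠ 0 := by
  obtain ⟨t, ht⟩ := exists_unitPhase_eq (z := -1) (by simp)
  have ht0 : t ≠ 0 := by
    rintro rfl
    rw [unitPhase_zero] at ht
    norm_num at ht
  obtain ⟨A, hA⟩ := UnitAddCircle.exists_extension (zmultiplesHom W w)
    (zmultiplesHom UnitAddCircle t) fun n hn => by
      have : n = 0 := by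
          exact ((IsAddTorsionFree.zsmul_eq_zero_iff_left hw).1 (by simpa using hn))
      rw [this, map_zero]
  refine ⟨ofHom A, ?_⟩
  have := hA 1
  simp only [zmultiplesHom_apply, one_smul] at this
  rwa [ofHom_apply, this]

section Module

variable [Module ℚ W]

noncomputable instance : SMul ℚ (CharGroup W) :=
  ⟨fun q x => ofHom (x.toHom.comp (DistribSMul.toAddMonoidHom W q))⟩

@[simp] theorem smul_apply (q : ℚ) (x : CharGroup W) (w : W) : (q • x) w = x (q • w) := rfl

noncomputable instance : Module ℚ (CharGroup W) where
  one_smul x := by ext w; simp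
  mul_smul q r x := by ext w; simp [smul_smul, mul_comm]
  smul_zero q := rfl
  smul_add q x y := rfl
  add_smul q r x := by ext w; simp [add_smul]
  zero_smul x := by
    ext w
    rw [smul_apply, zero_smul, map_zero]
    rfl

instance : ContinuousConstSMul ℚ (CharGroup W) :=
  ⟨fun q => continuous_of_apply fun w => continuous_apply (q • w)⟩

end Module

/-- Evaluation at `w` as a bounded continuous function. -/
noncomputable def phase : Multiplicative W →* BoundedContinuousFunction (CharGroup W) ℂ where
  toFun w := BoundedContinuousFunction.mkOfCompact
    ⟨fun x => unitPhase (x w.toAdd), continuous_unitPhase.comp (continuous_apply _)⟩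
  map_one' := by
    ext x
    change unitPhase (x 0) = 1
    rw [map_zero, unitPhase_zero]
  map_mul' v w := by
    ext x
    change unitPhase (x (v.toAdd + w.toAdd)) = _
    rw [map_add, unitPhase_add]
    rfl

variable (W) in
/-- The algebra of trigonometric polynomials. -/
noncomputable def trigPoly : Subalgebra ℂ (BoundedContinuousFunction (CharGroup W) ℂ) :=
  Algebra.adjoin ℂ (MonoidHom.mrange (phase (W := W))).carrier

theorem phase_mem_trigPoly (w : Multiplicative W) : phase w ∈ trigPoly W :=
  Algebra.subset_adjoin ⟨w, rfl⟩

theorem star_phase (w : Multiplicative W) : star (phase w) = phase w⁻¹ := by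
  ext x
  change conj (unitPhase (x w.toAdd)) = unitPhase (x (-w.toAdd))
  rw [map_neg, unitPhase_neg]

theorem mem_span_of_mem_trigPoly {f : BoundedContinuousFunction (CharGroup W) ℂ}
    (hf : f ∈ trigPoly W) :
    f ∈ Submodule.span ℂ (MonoidHom.mrange (phase (W := W))).carrier := by
  have h : f ∈ Subalgebra.toSubmodule (trigPoly W) := hf
  rw [trigPoly, Algebra.adjoin_eq_span] at h
  have e : (Submonoid.closure (MonoidHom.mrange (phase (W := W))).carrier)
    = MonoidHom.mrange (phase (W := W)) := Submonoid.closure_eq _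
  rw [e] at h
  exact h

theorem star_mem_trigPoly {f : BoundedContinuousFunction (CharGroup W) ℂ}
    (hf : f ∈ trigPoly W) : star f ∈ trigPoly W := by
  replace hf := mem_span_of_mem_trigPoly hf
  induction hf using Submodule.span_induction with
  | mem f hf =>
    obtain ⟨w, rfl⟩ := hf
    rw [star_phase]
    exact phase_mem_trigPoly _
  | zero => rw [star_zero]; exact zero_mem _
  | add f g _ _ h h' =>
    rw [star_add]
    exact add_mem h h'
  | smul a f _ h =>
    rw [star_smul]
    exact Subalgebra.smul_mem _ h _

/-- Uniqueness of Fourier coefficients: trigonometric polynomials form a point-separating star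
algebra and are spanned by the characters. -/
theorem measure_ext [Countable W] {μ ν : Measure (CharGroup W)} [IsFiniteMeasure μ]
    [IsFiniteMeasure ν] (h : ∀ w, ∫ x, unitPhase (x w) ∂μ = ∫ x, unitPhase (x w) ∂ν) :
    μ = ν := by
  let := TopologicalSpace.metrizableSpaceMetric (CharGroup W)
  have : PolishSpace (CharGroup W) := inferInstance
  refine ext_of_forall_mem_subalgebra_integral_eq_of_polish (𝕜 := ℂ) 
    (A := { trigPoly W with star_mem' := star_mem_trigPoly }) ?_ ?_
  · intro x y hxy
    obtain ⟨w, hw⟩ := DFunLike.ne_iff.1 hxy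
    refine ⟨_, ⟨BoundedContinuousFunction.toContinuousMapStarₐ ℂ (phase (.ofAdd w)),
      ⟨phase (.ofAdd w), phase_mem_trigPoly _, rfl⟩, rfl⟩, ?_⟩
    exact fun e => hw (unitPhase_injective e)
  · intro f hf
    have hf' := mem_span_of_mem_trigPoly (W := W) hf
    clear hf
    induction hf' using Submodule.span_induction with
    | mem f hf =>
      obtain ⟨w, rfl⟩ := hf
      exact h w.toAdd
    | zero => simp
    | add f g _ _ hf hg =>
      simp only [BoundedContinuousFunction.coe_add, Pi.add_apply]
      rw [integral_add (f.integrable μ) (g.integrable μ),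
        integral_add (f.integrable ν) (g.integrable ν), hf, hg]
    | smul a f _ hf =>
      simp only [BoundedContinuousFunction.coe_smul]
      rw [integral_smul, integral_smul, hf]

end CharGroup

/-! ### The map from `V^k` onto the dual of `P`. -/

namespace CharGroup

variable {P : Type v} {W : Type w} [AddCommGroup P] [AddCommGroup W]

/-- The homomorphism `V^k → Ĝ` dual to `p ↦ (i_j p)_j`, where `V` is the dual of `W`. -/
noncomputable def piDual (k : ℕ) (i : ℕ → P →+ W) : (Fin k → CharGroup W) →+ CharGroup P where
  toFun v := ofHom (AddMonoidHom.mk' (fun p => ∑ j, v j (i j p))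
    fun p q => by simp [Finset.sum_add_distrib])
  map_zero' := by ext p; simp
  map_add' v v' := by ext p; simp [Finset.sum_add_distrib]

theorem piDual_apply (k : ℕ) (i : ℕ → P →+ W) (v : Fin k → CharGroup W) (p : P) :
    piDual k i v p = ∑ j, v j (i j p) := rfl

theorem continuous_piDual (k : ℕ) (i : ℕ → P →+ W) : Continuous (piDual k i) :=
  continuous_of_apply fun p => by
    simp only [piDual_apply]
    exact continuous_finsetSum _ fun j _ =>
      (continuous_apply (i j p)).comp (_root_.continuous_apply j)

/-- The coordinate paired with the injective `i 0` already suffices. For `k = 0` that map is also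
zero, so `P` is trivial. -/
theorem piDual_surjective {k : ℕ} {i : ℕ → P →+ W} (hi : Function.Injective (i 0))
    (hk : ∀ j ≥ k, i j = 0) : Function.Surjective (piDual k i) := by
  intro x
  obtain ⟨A, hA⟩ := UnitAddCircle.exists_extension (i 0) x.toHom fun p hp => by
    rw [hi (hp.trans (map_zero _).symm), map_zero]
  cases k with
  | zero =>
    refine ⟨0, ext fun p => ?_⟩
    have : p = 0 := hi (by simp [hk 0 le_rfl])
    rw [this, map_zero, map_zero]
  | succ k =>
    refine ⟨Fin.cons (ofHom A) 0, ext fun p => ?_⟩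
    simp [piDual_apply, Fin.sum_univ_succ, hA]

/-- The affine action of `ℚ` on the dual of `P` attached to an action on `P` and a cocycle. -/
noncomputable abbrev affineAction {u : ℚ → AddMonoid.End P} (h0 : u 0 = 1)
    (hadd : ∀ q r, u (q + r) = u q * u r) {c : ℚ → P →+ UnitAddCircle}
    (hc : ∀ q r p, c (q + r) p = c q p + c r (u q p)) : AddAction ℚ (CharGroup P) where
  vadd q x := ofHom (x.toHom.comp (u q) + c q)
  zero_vadd x := ext fun p => by
    have c0 : c 0 p = 0 := by simpa [h0] using hc 0 0 p
    change x (u 0 p) + c 0 p = x p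
    rw [h0, c0, add_zero]
    rfl
  add_vadd q r x := ext fun p => by
    change x (u (q + r) p) + c (q + r) p = x (u r (u q p)) + c r (u q p) + c q p
    rw [hc, add_comm q r, hadd]
    change x (u r (u q p)) + _ = _
    abel

/-- Scalars act on `V` by transposition, so `binom(q, j - n)` moves from `v_n` onto `i_j p`. Both
sides become the same double sum over `n < j`, summed in opposite orders, while the `α` terms add up
to `c q p`. -/
theorem piDual_skewMap [Module ℚ W] {k : ℕ} {i : ℕ → P →+ W} (hk : ∀ j ≥ k, i j = 0)
    {u : ℚ → AddMonoid.End P}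
    (hu : ∀ q p n, i n (u q p) = ∑ m ∈ Finset.range k, Ring.choose q m • i (n + m) p)
    {c : ℚ → P →+ UnitAddCircle} {A : W →+ UnitAddCircle}
    (hA : ∀ q p, c q p = A (∑ j ∈ Finset.range k, Ring.choose q (j + 1) • i j p))
    (q : ℚ) (v : Fin k → CharGroup W) (p : P) :
    piDual k i (skewMap (ofHom A) q v) p = piDual k i v (u q p) + c q p := by
  have apply_sum {ι : Type} (s : Finset ι) (f : ι → CharGroup W) (w : W) :
      (∑ a ∈ s, f a) w = ∑ a ∈ s, f a w := by
    classical
    induction s using Finset.induction_on with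
    | empty => rfl
    | insert a s ha ih => rw [Finset.sum_insert ha, Finset.sum_insert ha, add_apply, ih]
  have h1 (n : Fin k) : i n (u q p) = i n p
      + ∑ j ∈ Finset.Ioi n, Ring.choose q ((j : ℕ) - (n : ℕ)) • i j p := by
    -- Terms with `n + m ≥ k` vanish; the substitution `j = n + m` follows.
    have e1 : ∑ m ∈ Finset.range k, Ring.choose q m • i (n + m) p
        = ∑ m ∈ Finset.range (k - n), Ring.choose q m • i (n + m) p := by
      symm
      refine Finset.sum_subset (by simp) fun m _ hm => ?_
      rw [hk _ (by simp at hm; omega), AddMonoidHom.zero_apply, smul_zero]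
    have e2 : k - (n : ℕ) = (k - n - 1) + 1 := by have := n.2; omega
    have e3 : (Finset.Ioi n).map Fin.valEmbedding
        = (Finset.range (k - n - 1)).map (addLeftEmbedding ((n : ℕ) + 1)) := by
      ext a
      simp only [Fin.map_valEmbedding_Ioi, Finset.mem_Ioo, Finset.mem_map, Finset.mem_range,
        addLeftEmbedding_apply]
      constructor
      · rintro ⟨h, h'⟩
        exact ⟨a - n - 1, by omega, by omega⟩
      · rintro ⟨b, h, rfl⟩
        omega
    have e4 : ∑ j ∈ Finset.Ioi n, Ring.choose q ((j : ℕ) - (n : ℕ)) • i j p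
        = ∑ j ∈ (Finset.Ioi n).map Fin.valEmbedding, Ring.choose q (j - (n : ℕ)) • i j p := by
      rw [Finset.sum_map]
      rfl
    rw [hu, e1, e2, Finset.sum_range_succ', e4, e3, Finset.sum_map, add_comm]
    congr 1
    · simp
    · refine Finset.sum_congr rfl fun m _ => ?_
      simp only [addLeftEmbedding_apply]
      congr 2
      · omega
      · congr 1
        omega
  have h2 : c q p = ∑ j : Fin k, A (Ring.choose q ((j : ℕ) + 1) • i j p) := by
    rw [hA, map_sum, Finset.sum_range]
  have h3 (j : Fin k) : (skewMap (ofHom A) q v) j (i j p)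
      = v j (i j p) + ∑ n ∈ Finset.Iio j, v n (Ring.choose q ((j : ℕ) - (n : ℕ)) • i j p)
        + A (Ring.choose q ((j : ℕ) + 1) • i j p) := by
    rw [skewMap, add_apply, add_apply, apply_sum]
    rfl
  have h4 (n : Fin k) : v n (i n (u q p)) = v n (i n p)
      + ∑ j ∈ Finset.Ioi n, v n (Ring.choose q ((j : ℕ) - (n : ℕ)) • i j p) := by
    rw [h1, map_add, map_sum]
  rw [piDual_apply, piDual_apply, h2]
  simp only [h3, h4, Finset.sum_add_distrib]
  congr 2
  refine Finset.sum_comm' fun j n => ?_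
  simp

/-- Translating by a `v₀` with nontrivial phase at `p` multiplies the integral by that phase. -/
theorem integral_piDual_eq_zero [Countable P] [IsAddTorsionFree P] {k : ℕ} {i : ℕ → P →+ W}
    (hi : Function.Injective (i 0)) (hk : ∀ j ≥ k, i j = 0) {p : P} (hp : p ≠ 0) :
    ∫ v, unitPhase (piDual k i v p) ∂(Measure.pi fun _ : Fin k => haarProb (CharGroup W)) = 0 := by
  obtain ⟨x, hx⟩ := exists_apply_ne_zero hp
  obtain ⟨v₀, hv₀⟩ := piDual_surjective hi hk x
  have h := integral_add_right_eq_self (μ := Measure.pi fun _ : Fin k => haarProb (CharGroup W))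
    (fun v => unitPhase (piDual k i v p)) v₀
  simp only [map_add, add_apply, hv₀, unitPhase_add, integral_mul_const] at h
  by_contra h0
  exact hx (unitPhase_injective ((mul_left_cancel₀ h0 (by rw [h, mul_one])).trans
    unitPhase_zero.symm))

end CharGroup

/-! ### Recovering `X` from its phase polynomials. -/

namespace QSystem

variable {X : QSystem.{u}}

theorem exists_measurable_charGroup_lift {P : Type v} [AddCommGroup P] [Countable P]
    (s : P →+ X.AngleFun) :
    ∃ φ : X → CharGroup P, Measurable φ ∧ ∀ᵐ x ∂X.μ, ∀ p, φ x p = s p x := by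
  classical
  let S : Set X := {x | ∀ p p', s (p + p') x = s p x + s p' x}
  have hS : MeasurableSet S := by
    have : S = ⋂ (p) (p'), {x | s (p + p') x = s p x + s p' x} := by ext; simp [S]
    rw [this]
    exact MeasurableSet.iInter fun p => MeasurableSet.iInter fun p' =>
      measurableSet_eq_fun (s _).measurable ((s _).measurable.add (s _).measurable)
  have hS' : ∀ᵐ x ∂X.μ, x ∈ S := by
    refine ae_all_iff.2 fun p => ae_all_iff.2 fun p' => ?_
    filter_upwards [AEEqFun.coeFn_add (s p) (s p')] with x hx
    rw [map_add, hx, Pi.add_apply]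
  -- As `P` is countable, additivity holds for all pairs at once off a null set; there the value is
  -- `0`.
  let φ : X → CharGroup P := fun x =>
    if h : x ∈ S then CharGroup.ofHom (AddMonoidHom.mk' (fun p => s p x) h) else 0
  have hφ (x) (p) : φ x p = S.indicator (fun x => s p x) x := by
    by_cases h : x ∈ S
    · rw [Set.indicator_of_mem h, show φ x = _ from dif_pos h]
      rfl
    · rw [Set.indicator_of_notMem h, show φ x = _ from dif_neg h]
      rfl
  refine ⟨φ, CharGroup.measurable_of_apply fun p => ?_, ?_⟩
  · simp only [hφ]
    exact (s p).measurable.indicator hS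
  · filter_upwards [hS'] with x hx p
    rw [hφ, Set.indicator_of_mem hx]

/-- One bounded real coordinate embeds `X` measurably. It lies in `L²`, hence factors through `φ`,
and inverting the coordinate recovers the point. -/
theorem exists_measurable_leftInverse {Y : Type v} [MeasurableSpace Y] {φ : X → Y}
    (h : ∀ f : Lp ℂ 2 X.μ, ∃ g : Y → ℂ, Measurable g ∧ f =ᵐ[X.μ] fun x => g (φ x)) :
    ∃ ψ : Y → X, Measurable ψ ∧ ∀ᵐ x ∂X.μ, ψ (φ x) = x := by
  let := TopologicalSpace.metrizableSpaceMetric X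
  have : PolishSpace X := inferInstance
  have : Nonempty X := nonempty_of_isProbabilityMeasure X.μ
  have hF : MeasurableEmbedding fun x : X =>
      (((unitInterval.sigmoid (embeddingReal X x) : unitInterval) : ℝ) : ℂ) :=
    Complex.isometry_ofReal.isClosedEmbedding.measurableEmbedding.comp
      ((MeasurableEmbedding.subtype_coe measurableSet_Icc).comp
        (measurableEmbedding_sigmoid_comp_embeddingReal X))
  obtain ⟨r, hr, hr'⟩ := hF.exists_measurable_extend measurable_id fun _ => inferInstance
  have hmem : MemLp (fun x : X =>
      (((unitInterval.sigmoid (embeddingReal X x) : unitInterval) : ℝ) : ℂ)) 2 X.μ := by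
    refine MemLp.of_bound hF.measurable.aestronglyMeasurable 1 (ae_of_all _ fun x => ?_)
    rw [Complex.norm_real, Real.norm_eq_abs, abs_of_nonneg (unitInterval.nonneg _)]
    exact unitInterval.le_one _
  obtain ⟨g, hg, hg'⟩ := h hmem.toLp
  refine ⟨r ∘ g, hr.comp hg, ?_⟩
  filter_upwards [hg', hmem.coeFn_toLp] with x h1 h2
  rw [Function.comp_apply, ← h1, h2]
  exact congrFun hr' x

/-- Composition with `φ` is an isometry of `L²` spaces, so its range is closed; it contains the
phase polynomials, whose span is dense. -/
theorem exists_comp_eq_of_isAbramov {k : ℕ} (hA : X.IsAbramov k) {Y : Type v} [MeasurableSpace Y]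
    {φ : X → Y} (hφ : Measurable φ)
    (h : ∀ g ∈ X.polyFiltration (k + 1), ∃ b : Y → ℂ, Measurable b ∧ (∀ y, ‖b y‖ = 1) ∧
      ∀ᵐ x ∂X.μ, unitPhase (g x) = b (φ x)) (f : Lp ℂ 2 X.μ) :
    ∃ g : Y → ℂ, Measurable g ∧ f =ᵐ[X.μ] fun x => g (φ x) := by
  have hφ' : MeasurePreserving φ X.μ (X.μ.map φ) := hφ.measurePreserving _
  have : IsProbabilityMeasure (X.μ.map φ) := Measure.isProbabilityMeasure_map hφ.aemeasurable
  let Φ := Lp.compMeasurePreservingₗᵢ ℂ (E := ℂ) (p := 2) φ hφ'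
  have hclosed : IsClosed (LinearMap.range Φ.toLinearMap : Set (Lp ℂ 2 X.μ)) :=
    Φ.isometry.isClosedEmbedding.isClosed_range
  have hle : Submodule.span ℂ {f : Lp ℂ 2 X.μ | X.IsPhasePolynomial k f}
      ≤ LinearMap.range Φ.toLinearMap := by
    refine Submodule.span_le.2 fun f hf => ?_
    obtain ⟨g, hg, hfg⟩ := IsPhasePolynomial.exists_mem_polyFiltration hf
    obtain ⟨b, hb, hb1, hgb⟩ := h g hg
    have hbm : MemLp b 2 (X.μ.map φ) :=
      MemLp.of_bound hb.aestronglyMeasurable 1 (ae_of_all _ fun y => (hb1 y).le)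
    refine ⟨hbm.toLp, ?_⟩
    refine Lp.ext ?_
    have h1 : Φ hbm.toLp =ᵐ[X.μ] hbm.toLp ∘ φ := Lp.coeFn_compMeasurePreserving _ hφ'
    filter_upwards [h1, hφ'.quasiMeasurePreserving.ae hbm.coeFn_toLp, hfg, hgb] with x h1 h2 h3 h4
    change Φ hbm.toLp x = f x
    rw [h1, Function.comp_apply, h2, h3, h4]
  have htop : f ∈ LinearMap.range Φ.toLinearMap := by
    have h2 := Submodule.topologicalClosure_minimal _ hle hclosed
    rw [hA] at h2
    exact h2 trivial
  obtain ⟨g, rfl⟩ := htop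
  exact ⟨g, (Lp.stronglyMeasurable g).measurable, Lp.coeFn_compMeasurePreserving g hφ'⟩

end QSystem

namespace QSystem

/-- The affine `ℚ`-system on the dual of `P` attached to an action on `P` and a cocycle. -/
noncomputable def affineSystem {P : Type v} [AddCommGroup P] [Countable P]
    {u : ℚ → AddMonoid.End P} (h0 : u 0 = 1) (hadd : ∀ q r, u (q + r) = u q * u r)
    {c : ℚ → P →+ UnitAddCircle} (hc : ∀ q r p, c (q + r) p = c q p + c r (u q p))
    (ν : Measure (CharGroup P)) [IsProbabilityMeasure ν]
    (hν : ∀ q, MeasurePreserving (fun x => CharGroup.ofHom (x.toHom.comp (u q) + c q)) ν ν) :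
    QSystem.{v} :=
  letI := CharGroup.affineAction h0 hadd hc
  { carrier := CharGroup P
    continuousAction := ⟨fun q => CharGroup.continuous_of_apply fun p =>
      (CharGroup.continuous_apply (u q p)).add continuous_const⟩
    μ := ν
    invariant := ⟨fun q _ hs => (hν q).measure_preimage hs.nullMeasurableSet⟩ }

variable {X : QSystem.{u}} {Y : QSystem.{v}}

/-- A one-sided inverse suffices, because statements almost everywhere on `Y` may be tested along
`φ`. -/
theorem IsFactorMap.isMeasurableIso {φ : X → Y} (hφ : X.IsFactorMap Y φ) {ψ : Y → X}
    (hψ : Measurable ψ) (h : ∀ᵐ x ∂X.μ, ψ (φ x) = x) :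
    X.IsMeasurableIso Y φ ∧ Y.IsFactorMap X ψ ∧ ∀ᵐ y ∂Y.μ, φ (ψ y) = y := by
  let := TopologicalSpace.metrizableSpaceMetric X
  let := TopologicalSpace.metrizableSpaceMetric Y
  have hm := hφ.measurePreserving
  have h1 : Y.IsFactorMap X ψ := by
    refine ⟨⟨hψ, ?_⟩, fun q => ?_⟩
    · have h' : ψ ∘ φ =ᵐ[X.μ] id := h
      rw [← hm.map_eq, Measure.map_map hψ hm.measurable, Measure.map_congr h', Measure.map_id]
    · have hq : MeasurableSet {y : Y | ψ (q +ᵥ y) = q +ᵥ ψ y} :=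
        measurableSet_eq_fun (hψ.comp (measurable_const_vadd q)) (hψ.const_vadd q)
      rw [← hm.map_eq, ae_map_iff hm.aemeasurable hq]
      filter_upwards [h, X.ae_vadd h q, hφ.equivariant q] with x h1 h2 h3
      rw [← h3, h1, h2]
  have h2 : ∀ᵐ y ∂Y.μ, φ (ψ y) = y := by
    have hq : MeasurableSet {y : Y | φ (ψ y) = y} :=
      measurableSet_eq_fun (hm.measurable.comp hψ) measurable_id
    rw [← hm.map_eq, ae_map_iff hm.aemeasurable hq]
    filter_upwards [h] with x hx
    rw [hx]
  exact ⟨⟨hφ, ψ, h1, h, h2⟩, h1, h2⟩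

theorem IsTopologicalFactorMap.comp_isFactorMap {Z : QSystem.{w}} {π : Z → Y}
    (hπ : Z.IsTopologicalFactorMap Y π) {ψ : Y → X} (hψ : Y.IsFactorMap X ψ) :
    Z.IsFactorMap X (ψ ∘ π) := by
  refine ⟨hψ.measurePreserving.comp hπ.measurePreserving, fun q => ?_⟩
  filter_upwards [hπ.measurePreserving.quasiMeasurePreserving.ae (hψ.equivariant q)] with z hz
  rw [Function.comp_apply, hπ.equivariant, hz, Function.comp_apply]

end QSystem

/-! ### Assembling the factor maps. -/

theorem mainTheorem4 (k : ℕ) (X : QSystem.{u}) (hX : X.IsErgodic) (hA : X.IsAbramov k) :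
    ∃ (V : Type) (_ : AddCommGroup V) (_ : Module ℚ V) (_ : TopologicalSpace V)
      (_ : IsTopologicalAddGroup V) (_ : ContinuousConstSMul ℚ V) (_ : CompactSpace V)
      (_ : TopologicalSpace.MetrizableSpace V) (_ : MeasurableSpace V) (_ : BorelSpace V)
      (α : V) (π : skewProduct k α → X),
      (skewProduct k α).IsFactorMap X π ∧
      ∃ (X' : QSystem.{0}) (φ : X → X') (π' : skewProduct k α → X'),
        X.IsMeasurableIso X' φ ∧
        (skewProduct k α).IsTopologicalFactorMap X' π' ∧
        π' =ᵐ[(skewProduct k α).μ] φ ∘ π := by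
  obtain ⟨P, _, _, _, s, u, c, h0, hadd, hk, hc, hs, hint, hspan⟩ :=
    QSystem.exists_polynomial_group hX k
  obtain ⟨i, A, hi, hik, hiu, hcA⟩ := exists_unipotent_embedding h0 hadd hk hc
  obtain ⟨φ, hφ, hφs⟩ := QSystem.exists_measurable_charGroup_lift s
  let α : CharGroup (DivisibleHull P) := CharGroup.ofHom A
  let Z := skewProduct k α
  let π' : Z → CharGroup P := CharGroup.piDual k i
  have hπ'c : Continuous π' := CharGroup.continuous_piDual k i
  -- Under both measures every nontrivial character of the dual of `P` integrates to zero.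
  have hν : X.μ.map φ = Z.μ.map π' := by
    have : IsProbabilityMeasure (X.μ.map φ) := Measure.isProbabilityMeasure_map hφ.aemeasurable
    have : IsProbabilityMeasure (Z.μ.map π') :=
      Measure.isProbabilityMeasure_map hπ'c.measurable.aemeasurable
    refine CharGroup.measure_ext fun p => ?_
    rcases eq_or_ne p 0 with rfl | hp
    · simp
    · have hm : StronglyMeasurable fun x : CharGroup P => unitPhase (x p) :=
        (continuous_unitPhase.comp (CharGroup.continuous_apply p)).stronglyMeasurable
      rw [integral_map hφ.aemeasurable hm.aestronglyMeasurable,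
        integral_map hπ'c.measurable.aemeasurable hm.aestronglyMeasurable]
      have h1 : ∫ x, unitPhase (φ x p) ∂X.μ = 0 := by
        rw [← hint p hp]
        refine integral_congr_ae ?_
        filter_upwards [hφs] with x hx
        rw [hx]
      exact h1.trans (CharGroup.integral_piDual_eq_zero hi hik hp).symm
  have hπ'e (q : ℚ) (v : Z) :
      π' (q +ᵥ v) = CharGroup.ofHom ((π' v).toHom.comp (u q) + c q) :=
    CharGroup.ext fun p => CharGroup.piDual_skewMap hik hiu hcA q v p
  have hprob : IsProbabilityMeasure (Z.μ.map π') :=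
    Measure.isProbabilityMeasure_map hπ'c.measurable.aemeasurable
  have hinv (q : ℚ) : MeasurePreserving (fun x => CharGroup.ofHom (x.toHom.comp (u q) + c q))
      (Z.μ.map π') (Z.μ.map π') := by
    have hm : Measurable fun x : CharGroup P => CharGroup.ofHom (x.toHom.comp (u q) + c q) :=
      (CharGroup.continuous_of_apply fun p =>
        (CharGroup.continuous_apply (u q p)).add continuous_const).measurable
    refine ⟨hm, ?_⟩
    rw [Measure.map_map hm hπ'c.measurable]
    conv_rhs => rw [← (measurePreserving_vadd q Z.μ).map_eq,
      Measure.map_map hπ'c.measurable (measurable_const_vadd q)]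
    congr 1
    funext v
    exact (hπ'e q v).symm
  let X' : QSystem.{0} := QSystem.affineSystem h0 hadd hc (Z.μ.map π') hinv
  have hφX : X.IsFactorMap X' φ := by
    refine ⟨⟨hφ, hν⟩, fun q => ?_⟩
    have hsx : ∀ᵐ x ∂X.μ, ∀ p, s p (q +ᵥ x) = s (u q p) x + c q p := by
      refine ae_all_iff.2 fun p => ?_
      filter_upwards [X.coeFn_koopman q (s p), X.coeFn_constHom (c q p),
        AEEqFun.coeFn_add (s (u q p)) (X.constHom (c q p))] with x h1 h2 h3
      rw [← h1, hs, h3, Pi.add_apply, h2]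
    filter_upwards [hφs, X.ae_vadd hφs q, hsx] with x h1 h2 h3
    refine CharGroup.ext fun p => ?_
    rw [h2, h3, ← h1]
    rfl
  have hπ' : Z.IsTopologicalFactorMap X' π' :=
    ⟨⟨hπ'c.measurable, rfl⟩, hπ'c, CharGroup.piDual_surjective hi hik, hπ'e⟩
  -- A polynomial `s p + t` is a function of `φ x`, namely evaluation at `p` shifted by `t`.
  obtain ⟨ψ, hψ, hψφ⟩ := QSystem.exists_measurable_leftInverse (φ := φ)
    (QSystem.exists_comp_eq_of_isAbramov hA hφ fun g hg => by
      obtain ⟨p, t, rfl⟩ := hspan g hg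
      refine ⟨fun y => unitPhase (y p + t), ?_, fun y => norm_unitPhase _, ?_⟩
      · exact (continuous_unitPhase.comp
          ((CharGroup.continuous_apply p).add continuous_const)).measurable
      · filter_upwards [hφs, AEEqFun.coeFn_add (s p) (X.constHom t), X.coeFn_constHom t]
          with x h1 h2 h3
        rw [h2, Pi.add_apply, h3, h1])
  obtain ⟨hiso, hψX, hφψ⟩ := hφX.isMeasurableIso hψ hψφ
  refine ⟨CharGroup (DivisibleHull P), inferInstance, inferInstance, inferInstance, inferInstance,
    inferInstance, inferInstance, inferInstance, inferInstance, inferInstance, α, ψ ∘ π',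
    hπ'.comp_isFactorMap hψX, X', φ, π', hiso, hπ', ?_⟩
  filter_upwards [hπ'.measurePreserving.quasiMeasurePreserving.ae hφψ] with z hz
  exact hz.symm
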